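/- **Setting.** $\mathcal{B}_2^d$ is the closed Euclidean unit ball of $\mathbb{R}^d$. A probability distribution $D$ on $\mathcal{B}_2^d\times\{\pm1\}$ has *margin* $\gamma$ if there is $w^*\in\mathcal{B}_2^d$ with $\Pr_{(x,y)\sim D}[y\langle w^*,x\rangle\ge\gamma]=1$. A randomized algorithm $\mathcal{A}$ is an *$(\alpha,\beta,\gamma)$-PAC learner for halfspaces in $\mathbb{R}^d$ with margin $\gamma$ and sample complexity $n$* if, for every $D$ with margin $\gamma$, given $S\sim D^n$ it outputs $\hat w\in\mathcal{B}_2^d$ such that, with probability at least $1-\beta$ over $S$ and the internal randomness, $\Pr_{(x,y)\sim D}[y=\mathrm{sign}\langle\hat w,x\rangle]\ge1-\alpha$ (with $\mathrm{sign}\,0=0$, so that a point with $\langle \hat w,x\rangle=0$ counts as an error). **Algorithm** $\mathcal{A}_{\alpha,\beta,\epsilon,\delta,\gamma}(S)$, for a data set $S=((x_i,y_i))_{i\le n}$ with $n\ge1$, a constant $K>0$, and a starting point $w_1\in\mathcal{B}_2^m$: 1. Let $\beta_{JL}=\alpha\beta^2/(64n)$ and $m=\lceil K\log(1/\beta_{JL})/\gamma^2\rceil$.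 Draw $A\in\mathbb{R}^{m\times d}$ with independent entries, uniform on $\{\pm1/\sqrt m\}$. 2. Let $S_A=((Ax_i/\|Ax_i\|_2,\,y_i))_{i\le n}$ (a point with $Ax_i=0$ is sent to $0$). 3. Let $\mathcal C=\mathcal{B}_2^m$, with diameter $2$, let $\ell(w;(x,y))=\mathbf 1\{y\langle w,x\rangle<\tfrac{96\gamma}{100}\}\bigl(\tfrac{96}{86}-\tfrac{y\langle w,x\rangle}{86\gamma/100}\bigr)$, which is $L$-Lipschitz on $\mathcal C$ with $L=\tfrac{100}{86\gamma}$, and let $\mathcal L(w;T)=\sum_{z\in T}\ell(w;z)$. 4. With $k=\lceil\log(8/\beta)\rceil$, $\epsilon'=\epsilon/k$ and $\delta'=\delta/k$, run noisy stochastic gradient descent independently $k$ times on $S_A$: put $\sigma^2=32L^2n^2\log(n/\delta')\log(1/\delta')/\epsilon'^2$ and $\eta(t)=2/\sqrt{t(n^2L^2+m\sigma^2)}$. Start at $w_1$, and for $t=1,\dots,n^2-1$ draw $z_t$ uniformly from $S_A$ with replacement and $b_t\sim\mathcal N(0,\sigma^2I_m)$, and set $w_{t+1}=\Pi_{\mathcal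 C}\bigl(w_t-\eta(t)[n\nabla\ell(w_t;z_t)+b_t]\bigr)$, where $\Pi_{\mathcal C}$ is the Euclidean projection and $\nabla\ell$ is taken to be $0$ at the kink of $\ell$. The result of the run is $w_{n^2}$. 5. From the $k$ results $\hat w^{(1)},\dots,\hat w^{(k)}$ select $\hat w=\hat w^{(i)}$ by the exponential mechanism, with probability proportional to $\exp\bigl(-\epsilon\,\mathcal L(\hat w^{(i)};S_A)/(2\Delta)\bigr)$, where $\Delta$ is the maximum of $|\mathcal L(\hat w^{(j)};T)-\mathcal L(\hat w^{(j)};T')|$ over $j\le k$ and over all data sets $T,T'\in(\mathcal{B}_2^m\times\{\pm1\})^n$ that differ in at most one point (uniformly if $\Delta=0$). 6. Return $\hat w^\top A\in\mathbb{R}^d$. **Theorem (Sample complexity).** There is an absolute constant $K_0>0$ such that for every $K\ge K_0$ there are $C>0$ and $c\in\mathbb{N}$, depending only on $K$, with the following property. For all $d$, all $\alpha,\beta,\gamma,\epsilon,\delta\in(0,1]$, all $$n\ \ge\ \frac{1}{\alpha\epsilon\gamma^2}\cdot C\Bigl(1+\log\tfrac1\alpha+\log\tfrac1\beta+\log\tfrac1\delta+\log\tfrac1\epsilon+\log\tfrac1\gamma\Bigr)^c,$$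 and all $w_1\in\mathcal{B}_2^m$, the algorithm $\mathcal{A}_{\alpha,\beta,\epsilon,\delta,\gamma}$, its output vector being projected to $\mathcal{B}_2^d$ (a positive rescaling, which does not change the halfspace), is an $(\alpha,\beta,\gamma)$-PAC learner for halfspaces in $\mathbb{R}^d$ with margin $\gamma$ and sample complexity $n$. In particular, sample complexity $n=\frac{1}{\alpha\epsilon\gamma^2}\cdot\mathrm{polylog}\bigl(\frac1\alpha,\frac1\beta,\frac1\delta,\frac1\epsilon,\frac1\gamma\bigr)$ suffices, independently of $d$. -/

import Mathlib

open MeasureTheory ProbabilityTheory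

noncomputable section

namespace PrivateHalfspace

/-- `ℝ^d` with the Euclidean norm. -/
abbrev E (d : ℕ) : Type := EuclideanSpace ℝ (Fin d)

/-- Labeled examples `(x, y)`, with `x ∈ ℝ^d` and `y ∈ {±1}`. -/
abbrev Example (d : ℕ) : Type := E d × ℤˣ

/-- The label `y ∈ {±1}` as a real number. -/
def label {d : ℕ} (z : Example d) : ℝ := ((z.2 : ℤ) : ℝ)

/-- The signed margin `y ⟨w, x⟩`. -/
def margin {d : ℕ} (w : E d) (z : Example d) : ℝ := label z * inner ℝ w z.1

/-- The Euclidean projection onto the closed unit ball. -/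
def projBall {d : ℕ} (w : E d) : E d := (max 1 ‖w‖)⁻¹ • w

/-! ### Learning halfspaces with a margin -/

/-- `D` is a distribution over `B₂^d × {±1}` with margin `γ`. -/
def HasMargin {d : ℕ} (γ : ℝ) (D : Measure (Example d)) : Prop :=
  IsProbabilityMeasure D ∧ (∀ᵐ z ∂D, ‖z.1‖ ≤ 1) ∧
    ∃ w : E d, ‖w‖ ≤ 1 ∧ ∀ᵐ z ∂D, γ ≤ margin w z

/-- `Pr_{(x,y) ∼ D} [y = sign ⟨w, x⟩]`. Here `Real.sign 0 = 0`, so that a point with `⟨w, x⟩ = 0`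
is never classified correctly. -/
def accuracy {d : ℕ} (D : Measure (Example d)) (w : E d) : ℝ :=
  D.real {z | label z = Real.sign (inner ℝ w z.1)}

/-- The randomized algorithm `𝒜`, given by its output law on every data set of size `n`, is an
`(α, β, γ)`-PAC learner for halfspaces in `ℝ^d` with margin `γ` and sample complexity `n`. -/
def IsPACLearner {d : ℕ} (α β γ : ℝ) (n : ℕ) (𝒜 : (Fin n → Example d) → Measure (E d)) : Prop :=
  Measurable 𝒜 ∧
  (∀ S, IsProbabilityMeasure (𝒜 S)) ∧
  (∀ S, ∀ᵐ w ∂(𝒜 S), ‖w‖ ≤ 1) ∧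
  ∀ D : Measure (Example d), HasMargin γ D →
    1 - β ≤ ((Measure.pi fun _ : Fin n => D).bind 𝒜).real {w | 1 - α ≤ accuracy D w}

/-! ### The exponential mechanism -/

/-- Two data sets are neighbors if they differ in at most one data point. -/
def Neighbors {n : ℕ} {Z : Type} (S S' : Fin n → Z) : Prop :=
  ∃ i, ∀ j, j ≠ i → S j = S' j

/-- The sensitivity of a utility function `u`, for data sets with points in `𝒵`. -/
def sensitivity {n : ℕ} {Z O : Type} (𝒵 : Set Z) (u : (Fin n → Z) → O → ℝ) : ℝ :=
  sSup {r | ∃ (o : O) (S S' : Fin n → Z), (∀ i, S i ∈ 𝒵) ∧ (∀ i, S' i ∈ 𝒵) ∧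
    Neighbors S S' ∧ r = |u S o - u S' o|}

/-- The weight `exp (ε u(S, o) / (2 Δu))` of `o` in the exponential mechanism. -/
def expWeight {n : ℕ} {Z O : Type} (ε : ℝ) (𝒵 : Set Z) (u : (Fin n → Z) → O → ℝ)
    (S : Fin n → Z) (o : O) : ℝ :=
  Real.exp (ε * u S o / (2 * sensitivity 𝒵 u))

/-- The law of the output of the exponential mechanism, over a finite range `O`. -/
def expMechanism {n : ℕ} {Z O : Type} [Fintype O] [MeasurableSpace O] (ε : ℝ) (𝒵 : Set Z)
    (u : (Fin n → Z) → O → ℝ) (S : Fin n → Z) : Measure O :=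
  ∑ o, ENNReal.ofReal (expWeight ε 𝒵 u S o / ∑ o', expWeight ε 𝒵 u S o') • Measure.dirac o

/-! ### The loss -/

/-- The loss `ℓ(w; (x, y)) = 1{y⟨w,x⟩ < 96γ/100} (96/86 - y⟨w,x⟩ / (86γ/100))`. -/
def loss {m : ℕ} (γ : ℝ) (w : E m) (z : Example m) : ℝ :=
  if margin w z < 96 * γ / 100 then 96 / 86 - margin w z / (86 * γ / 100) else 0

/-- The Lipschitz constant `100 / (86γ)` of the loss. -/
def lossLip (γ : ℝ) : ℝ := 100 / (86 * γ)

/-- The (sub)gradient of `w ↦ ℓ(w; z)`. On the kink `y⟨w,x⟩ = 96γ/100`, where the loss is not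
differentiable, the subgradient `0` is taken. -/
def lossGrad {m : ℕ} (γ : ℝ) (w : E m) (z : Example m) : E m :=
  if margin w z < 96 * γ / 100 then (-(label z * lossLip γ)) • z.1 else 0

/-- The total loss `ℒ(w; T) = ∑_{z ∈ T} ℓ(w; z)`. -/
def totalLoss {m n : ℕ} (γ : ℝ) (w : E m) (T : Fin n → Example m) : ℝ := ∑ i, loss γ w (T i)

/-! ### Private empirical risk minimization by noisy stochastic gradient descent -/

/-- The standard deviation `σ` of the noise, `σ² = 32 L² n² log(n/δ) log(1/δ) / ε²`. -/
def noiseSD (n : ℕ) (γ ε δ : ℝ) : ℝ :=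
  Real.sqrt (32 * lossLip γ ^ 2 * n ^ 2 * Real.log (n / δ) * Real.log (1 / δ) / ε ^ 2)

/-- The learning rate `η(t) = ‖𝒞‖₂ / √(t (n² L² + m σ²))`; the unit ball `𝒞` has diameter `2`. -/
def learningRate (m n : ℕ) (γ ε δ : ℝ) (t : ℕ) : ℝ :=
  2 / Real.sqrt (t * (n ^ 2 * lossLip γ ^ 2 + m * noiseSD n γ ε δ ^ 2))

/-- One step `Π_𝒞 (w - η(t) [n ∇ℓ(w; T i) + σ b])` of noisy gradient descent. -/
def noiseGDStep {m n : ℕ} (γ ε δ : ℝ) (T : Fin n → Example m) (t : ℕ)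
    (w : E m) (i : Fin n) (b : E m) : E m :=
  projBall (w - learningRate m n γ ε δ t • ((n : ℝ) • lossGrad γ w (T i) + noiseSD n γ ε δ • b))

/-- The law of the iterate `w_{s+1}` of noisy gradient descent on the data set `T`, started from
`w₁`: in each step the data point is drawn uniformly and the noise is a fresh Gaussian. -/
def noiseGDIterate {m n : ℕ} (γ ε δ : ℝ) (w₁ : E m) (T : Fin n → Example m) : ℕ → Measure (E m)
  | 0 => Measure.dirac w₁
  | s + 1 =>
    ((noiseGDIterate γ ε δ w₁ T s).prod
      ((uniformOn (Set.univ : Set (Fin n))).prod (stdGaussian (E m)))).map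
        fun p => noiseGDStep γ ε δ T (s + 1) p.1 p.2.1 p.2.2

/-- The law of the output `w_{n²}` of noisy gradient descent. -/
def noiseGD {m n : ℕ} (γ ε δ : ℝ) (w₁ : E m) (T : Fin n → Example m) : Measure (E m) :=
  noiseGDIterate γ ε δ w₁ T (n ^ 2 - 1)

/-- The number `⌈log(8/β)⌉` of independent runs. -/
def numRuns (β : ℝ) : ℕ := ⌈Real.log (8 / β)⌉₊

/-- The law of the output of the private empirical risk minimizer: `⌈log(8/β)⌉` independent runs
of noisy gradient descent with proportionally smaller privacy parameters, and a selection among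
the results by the exponential mechanism with utility `-ℒ`. -/
def privateERM {m n : ℕ} (β γ ε δ : ℝ) (w₁ : E m) (T : Fin n → Example m) : Measure (E m) :=
  (Measure.pi fun _ : Fin (numRuns β) => noiseGD γ (ε / numRuns β) (δ / numRuns β) w₁ T).bind
    fun W => (expMechanism ε {z : Example m | ‖z.1‖ ≤ 1}
      (fun T' i => -totalLoss γ (W i) T') T).map W

/-! ### The random projection and the algorithm -/

/-- `m = ⌈K log(1/β_JL) / γ²⌉` with `β_JL = αβ²/(64n)`. -/
def projDim (K α β γ : ℝ) (n : ℕ) : ℕ :=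
  ⌈K * Real.log (1 / (α * β ^ 2 / (64 * n))) / γ ^ 2⌉₊

/-- The law of an `m × d` array of independent uniform signs. -/
def signLaw (m d : ℕ) : Measure (Fin m → Fin d → ℤˣ) :=
  Measure.pi fun _ => Measure.pi fun _ => uniformOn (Set.univ : Set ℤˣ)

/-- The matrix with entries `±1/√m` and the given signs. -/
def signMatrix {m d : ℕ} (s : Fin m → Fin d → ℤˣ) : Matrix (Fin m) (Fin d) ℝ :=
  Matrix.of fun i j => ((s i j : ℤ) : ℝ) / Real.sqrt m

/-- The linear map `w ↦ A w` between Euclidean spaces. -/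
def matVec {m d : ℕ} (A : Matrix (Fin m) (Fin d) ℝ) (w : E d) : E m :=
  WithLp.toLp 2 (A.mulVec w.ofLp)

/-- The projected data set `S_A = {(Ax / ‖Ax‖, y)}`; a point with `Ax = 0` is sent to `0`. -/
def projectData {m d n : ℕ} (A : Matrix (Fin m) (Fin d) ℝ) (S : Fin n → Example d) :
    Fin n → Example m :=
  fun i => (‖matVec A (S i).1‖⁻¹ • matVec A (S i).1, (S i).2)

/-- The law of the output `ŵᵀ A` of the algorithm on the data set `S`. The parameter `K` is the
constant in the choice of the projection dimension, and `w₁` the starting point of the noisy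
gradient descent. -/
def halfspaceLearner {d : ℕ} (K α β γ ε δ : ℝ) (n : ℕ) (w₁ : E (projDim K α β γ n))
    (S : Fin n → Example d) : Measure (E d) :=
  (signLaw (projDim K α β γ n) d).bind fun s =>
    (privateERM β γ ε δ w₁ (projectData (signMatrix s) S)).map (matVec (signMatrix s).transpose)

end PrivateHalfspace

end

namespace PrivateHalfspace

/-! ### Labels and margins -/

/-! The proof bounds the failure probability by four events of probability at most `β / 8` each.

Projection. For a fixed sample and a fixed separator `w`, a random sign matrix `A` with `m` of order
`log (n / (α β ^ 2)) / γ ^ 2` rows preserves the squared norms of `w`, `x_i` and `w ± x_i` up to a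
factor `1 ± γ / 100` (`signLaw_distorts_le`). By polarization the inner products move by at most `γ
/ 100`, so `A w`, cut back to the ball, has margin at least `96 γ / 100` on all normalized projected
points (`le_margin_projBall_matVec`). Hence some point of the ball has empirical loss zero.

Optimization. With such a comparator, the last iterate of projected stochastic gradient descent with
steps `2 / (G √t)` has expected loss at most `G / √T * (4 + 3 log T)` (`integral_chain_last_le`).
Here `T = n ^ 2` and `G` is about `√m σ`. Since `√m` and the Lipschitz constant each cost `1 / γ`,
the loss is `polylog / (γ ^ 2 ε)`, independent of `d`. Markov's inequality with factor `e`, applied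
to `⌈log (8 / β)⌉` independent runs, makes one of them good (failure event two), and the exponential
mechanism loses only `polylog / (γ ε)` more (failure event three). Together this is at most `α n /
100` for `n` as in the theorem (`privateERM_lt_totalLoss_le`, `runBound_add_le`).

Generalization. For a fixed matrix, uniform convergence over a `γ / 5`-net of the `m`-dimensional
ball shows that a small empirical loss forces an error probability at most `α`
(`exists_measurableSet_error_le`). The logarithm of the net size is of order `m` up to logarithms.
The one-sided Chernoff bound costs only `exp (-α n / 2)`, so a sample of order `m / α`, up to
logarithms, suffices.

The projection bound is for fixed data and random `A`, the generalization bound for fixed `A` and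
random data; independence and Tonelli's theorem combine them in `bind_halfspaceLearner_error_le`. -/

instance : MeasurableSingletonClass ℤˣ where
  measurableSet_singleton u := by
    refine ⟨{(u : ℤ)}, measurableSet_singleton _, ?_⟩
    ext v
    simp [Units.ext_iff]

lemma label_eq_or {d : ℕ} (z : Example d) : label z = 1 ∨ label z = -1 := by
  unfold label
  rcases Int.units_eq_one_or z.2 with h | h <;> simp [h]

lemma abs_label {d : ℕ} (z : Example d) : |label z| = 1 := by
  rcases label_eq_or z with h | h <;> simp [h]

lemma measurable_unit_label : Measurable fun u : ℤˣ => ((u : ℤ) : ℝ) :=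
  measurable_of_countable _

@[fun_prop]
lemma measurable_label {d : ℕ} : Measurable (label (d := d)) :=
  measurable_unit_label.comp measurable_snd

@[fun_prop]
lemma measurable_margin {d : ℕ} {Ω : Type*} [MeasurableSpace Ω] {f : Ω → E d} {g : Ω → Example d}
    (hf : Measurable f) (hg : Measurable g) : Measurable fun ω => margin (f ω) (g ω) := by
  unfold margin
  exact (measurable_label.comp hg).mul (hf.inner (measurable_fst.comp hg))

@[fun_prop]
lemma continuous_margin {d : ℕ} (z : Example d) : Continuous fun w => margin w z := by
  unfold margin
  fun_prop

lemma abs_margin_le {d : ℕ} (w : E d) (z : Example d) : |margin w z| ≤ ‖w‖ * ‖z.1‖ := by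
  rw [margin, abs_mul, abs_label, one_mul]
  exact abs_real_inner_le_norm _ _

lemma margin_sub {d : ℕ} (w v : E d) (z : Example d) :
    margin (w - v) z = margin w z - margin v z := by
  simp [margin, inner_sub_left, mul_sub]

/-! ### The loss -/

/-- The affine branch vanishes exactly at the threshold `96 γ / 100`, so the truncated loss is a
hinge: continuous and convex in `w`. -/
lemma loss_eq_max {m : ℕ} {γ : ℝ} (hγ : 0 < γ) (w : E m) (z : Example m) :
    loss γ w z = max 0 (96 / 86 - margin w z / (86 * γ / 100)) := by
  unfold loss
  have h : margin w z / (86 * γ / 100) < 96 / 86 ↔ margin w z < 96 * γ / 100 := by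
    rw [div_lt_iff₀ (by positivity)]
    constructor <;> intro h <;> linarith
  split_ifs with h1
  · rw [max_eq_right]
    linarith [h.2 h1]
  · rw [max_eq_left]
    linarith [not_lt.1 (mt h.1 h1)]

lemma loss_nonneg {m : ℕ} {γ : ℝ} (hγ : 0 < γ) (w : E m) (z : Example m) : 0 ≤ loss γ w z := by
  rw [loss_eq_max hγ]
  exact le_max_left _ _

lemma loss_le {m : ℕ} {γ : ℝ} (hγ : 0 < γ) (hγ1 : γ ≤ 1) {w : E m} (hw : ‖w‖ ≤ 1) {z : Example m}
    (hz : ‖z.1‖ ≤ 1) : loss γ w z ≤ 3 / γ := by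
  rw [loss_eq_max hγ]
  have h1 := (abs_le.1 ((abs_margin_le w z).trans (mul_le_one₀ hw (norm_nonneg _) hz))).1
  refine max_le (by positivity) ?_
  have h2 : -(100 / 86 / γ) ≤ margin w z / (86 * γ / 100) := by
    rw [le_div_iff₀ (by positivity)]
    field_simp
    linarith
  have h3 : 1 ≤ 1 / γ := by rw [le_div_iff₀ hγ]; linarith
  have h4 : 3 / γ = 3 * (1 / γ) := by ring
  have h5 : 100 / 86 / γ = 100 / 86 * (1 / γ) := by ring
  rw [h4]
  rw [h5] at h2
  linarith

lemma loss_eq_zero {m : ℕ} {γ : ℝ} {w : E m} {z : Example m} (h : 96 * γ / 100 ≤ margin w z) :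
    loss γ w z = 0 := if_neg (not_lt.2 h)

/-- The threshold `2 γ / 5` is the net radius `γ / 5` plus the margin `γ / 5` at which points are
counted in the generalization bound. -/
lemma half_le_loss {m : ℕ} {γ : ℝ} (hγ : 0 < γ) {w : E m} {z : Example m}
    (h : margin w z ≤ 40 * γ / 100) : 1 / 2 ≤ loss γ w z := by
  rw [loss_eq_max hγ]
  refine le_max_of_le_right ?_
  have : margin w z / (86 * γ / 100) ≤ 40 / 86 := by
    rw [div_le_iff₀ (by positivity)]
    linarith
  linarith

lemma continuous_loss {m : ℕ} {γ : ℝ} (hγ : 0 < γ) (z : Example m) :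
    Continuous fun w => loss γ w z := by
  simp_rw [loss_eq_max hγ]
  fun_prop

lemma measurable_loss {m : ℕ} (γ : ℝ) {Ω : Type*} [MeasurableSpace Ω] {f : Ω → E m}
    {g : Ω → Example m} (hf : Measurable f) (hg : Measurable g) :
    Measurable fun ω => loss γ (f ω) (g ω) := by
  unfold loss
  refine Measurable.ite (measurableSet_lt (by fun_prop) (by fun_prop)) ?_ measurable_const
  exact measurable_const.sub ((measurable_margin hf hg).div_const _)

lemma measurable_lossGrad {m : ℕ} (γ : ℝ) {Ω : Type*} [MeasurableSpace Ω] {f : Ω → E m}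
    {g : Ω → Example m} (hf : Measurable f) (hg : Measurable g) :
    Measurable fun ω => lossGrad γ (f ω) (g ω) := by
  unfold lossGrad
  refine Measurable.ite (measurableSet_lt (by fun_prop) (by fun_prop)) ?_ measurable_const
  exact (((measurable_label.comp hg).mul_const _).neg).smul (measurable_fst.comp hg)

lemma norm_lossGrad_le {m : ℕ} {γ : ℝ} (hγ : 0 < γ) (w : E m) {z : Example m} (hz : ‖z.1‖ ≤ 1) :
    ‖lossGrad γ w z‖ ≤ lossLip γ := by
  have hL : 0 ≤ lossLip γ := by unfold lossLip; positivity
  unfold lossGrad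
  split_ifs
  · rw [norm_smul, norm_neg, norm_mul, Real.norm_eq_abs, abs_label, one_mul, Real.norm_eq_abs,
      abs_of_nonneg hL]
    exact mul_le_of_le_one_right hL hz
  · simpa using hL

/-- `lossGrad` is a subgradient of the loss. -/
lemma loss_sub_le_inner {m : ℕ} {γ : ℝ} (hγ : 0 < γ) (w v : E m) (z : Example m) :
    loss γ w z - loss γ v z ≤ inner ℝ (lossGrad γ w z) (w - v) := by
  by_cases h : margin w z < 96 * γ / 100
  · have h1 : loss γ w z = 96 / 86 - margin w z / (86 * γ / 100) := if_pos h
    have h2 : 96 / 86 - margin v z / (86 * γ / 100) ≤ loss γ v z := by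
      rw [loss_eq_max hγ]
      exact le_max_right _ _
    have h3 : inner ℝ (lossGrad γ w z) (w - v) = -(lossLip γ * (margin w z - margin v z)) := by
      rw [lossGrad, if_pos h, real_inner_smul_left, ← margin_sub, margin, real_inner_comm]
      ring
    have h4 : lossLip γ * (margin w z - margin v z)
        = margin w z / (86 * γ / 100) - margin v z / (86 * γ / 100) := by
      unfold lossLip
      field_simp
    rw [h3, h4, h1]
    linarith
  · rw [lossGrad, if_neg h, loss_eq_zero (not_lt.1 h), inner_zero_left]
    linarith [loss_nonneg hγ v z]

/-! ### The projection onto the ball -/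

lemma norm_projBall_le {d : ℕ} (w : E d) : ‖projBall w‖ ≤ 1 := by
  have h : 0 < max 1 ‖w‖ := lt_max_of_lt_left one_pos
  rw [projBall, norm_smul, norm_inv, Real.norm_eq_abs, abs_of_pos h, inv_mul_le_iff₀ h, mul_one]
  exact le_max_right _ _

lemma projBall_of_norm_le {d : ℕ} {w : E d} (hw : ‖w‖ ≤ 1) : projBall w = w := by
  rw [projBall, max_eq_left hw, inv_one, one_smul]

@[fun_prop]
lemma measurable_projBall {d : ℕ} : Measurable (projBall (d := d)) := by
  unfold projBall
  fun_prop

/-- For `‖u‖ > 1` and `q = ⟨u, v⟩ / ‖u‖ ≤ 1`, the squared distances differ by `(‖u‖ - 1) (‖u‖ + 1 -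
2 q) ≥ (‖u‖ - 1) ^ 2`. -/
lemma norm_projBall_sub_le {d : ℕ} (u : E d) {v : E d} (hv : ‖v‖ ≤ 1) :
    ‖projBall u - v‖ ≤ ‖u - v‖ := by
  rcases le_or_gt ‖u‖ 1 with h | h
  · rw [projBall_of_norm_le h]
  · have hr : projBall u = ‖u‖⁻¹ • u := by rw [projBall, max_eq_right h.le]
    have hpos : 0 < ‖u‖ := one_pos.trans h
    refine le_of_sq_le_sq ?_ (norm_nonneg _)
    rw [hr, norm_sub_sq_real, norm_sub_sq_real, norm_smul, norm_inv, norm_norm,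
      inv_mul_cancel₀ hpos.ne', real_inner_smul_left]
    have hc : inner ℝ u v ≤ ‖u‖ :=
      (real_inner_le_norm u v).trans (mul_le_of_le_one_right hpos.le hv)
    have hq : ‖u‖⁻¹ * inner ℝ u v ≤ 1 := by rwa [inv_mul_le_iff₀ hpos, mul_one]
    have he : inner ℝ u v = ‖u‖ * (‖u‖⁻¹ * inner ℝ u v) := by field_simp
    set q := ‖u‖⁻¹ * inner ℝ u v
    rw [he]
    nlinarith

/-! ### Markov chains driven by independent noise -/

section Chain

variable {X Ω : Type*} [MeasurableSpace X] [MeasurableSpace Ω]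

/-- The law after `r` steps of the chain `x ↦ f t x ω`, started at `v`, with fresh noise `ω ∼ ν` in
each step. -/
noncomputable def chain (ν : Measure Ω) (f : ℕ → X → Ω → X) (v : X) : ℕ → Measure X
  | 0 => Measure.dirac v
  | r + 1 => ((chain ν f v r).prod ν).map fun p => f r p.1 p.2

/-- Measurable functions that are bounded on `B`. -/
def BddMeas (B : Set X) (g : X → ℝ) : Prop := Measurable g ∧ ∃ C, ∀ x ∈ B, |g x| ≤ C

variable {ν : Measure Ω} {f : ℕ → X → Ω → X} {B : Set X} {g : X → ℝ}

lemma ae_mem_chain (hf : ∀ t, Measurable fun p : X × Ω => f t p.1 p.2) (hB : MeasurableSet B)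
    (hfB : ∀ t x ω, f t x ω ∈ B) {v : X} (hv : v ∈ B) (r : ℕ) :
    ∀ᵐ x ∂(chain ν f v r), x ∈ B := by
  cases r with
  | zero => exact (ae_dirac_iff hB).2 hv
  | succ r =>
    rw [chain, ae_map_iff (hf r).aemeasurable (p := fun x => x ∈ B) hB]
    exact Filter.Eventually.of_forall fun p => hfB _ _ _

/-- A bound on `B` is enough because the chain never leaves `B`; the loss itself is unbounded on the
whole space. -/
lemma BddMeas.integrable {μ : Measure X} [IsFiniteMeasure μ] (hg : BddMeas B g)
    (hμ : ∀ᵐ x ∂μ, x ∈ B) : Integrable g μ := by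
  obtain ⟨hm, C, hC⟩ := hg
  exact Integrable.of_bound hm.aestronglyMeasurable C (hμ.mono hC)

variable [IsProbabilityMeasure ν]

lemma isProbabilityMeasure_chain (hf : ∀ t, Measurable fun p : X × Ω => f t p.1 p.2) (v : X)
    (r : ℕ) : IsProbabilityMeasure (chain ν f v r) := by
  induction r with
  | zero => exact Measure.dirac.isProbabilityMeasure
  | succ r ih => exact Measure.isProbabilityMeasure_map (hf r).aemeasurable

lemma BddMeas.integral_comp (hg : BddMeas B g) (hf : ∀ t, Measurable fun p : X × Ω => f t p.1 p.2)
    (hfB : ∀ t x ω, f t x ω ∈ B) (t : ℕ) : BddMeas B fun x => ∫ ω, g (f t x ω) ∂ν := by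
  obtain ⟨hm, C, hC⟩ := hg
  refine ⟨?_, C, fun x _ => ?_⟩
  · exact (StronglyMeasurable.integral_prod_right (f := fun x ω => g (f t x ω))
      (hm.comp (hf t)).stronglyMeasurable).measurable
  · have := norm_integral_le_of_norm_le_const (μ := ν) (f := fun ω => g (f t x ω))
      (Filter.Eventually.of_forall fun ω => hC _ (hfB t x ω))
    simpa using this

lemma integral_chain_succ (hf : ∀ t, Measurable fun p : X × Ω => f t p.1 p.2)
    (hfB : ∀ t x ω, f t x ω ∈ B) (hg : BddMeas B g) (v : X)
    (r : ℕ) : ∫ x, g x ∂(chain ν f v (r + 1)) = ∫ x, ∫ ω, g (f r x ω) ∂ν ∂(chain ν f v r) := by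
  have := isProbabilityMeasure_chain (ν := ν) hf v r
  have := isProbabilityMeasure_chain (ν := ν) hf v (r + 1)
  rw [chain, integral_map (hf r).aemeasurable hg.1.aestronglyMeasurable, integral_prod]
  obtain ⟨hm, C, hC⟩ := hg
  exact Integrable.of_bound (hm.comp (hf r)).aestronglyMeasurable C
    (Filter.Eventually.of_forall fun p => hC _ (hfB _ _ _))

lemma bddMeas_integral_chain (hf : ∀ t, Measurable fun p : X × Ω => f t p.1 p.2)
    (hfB : ∀ t x ω, f t x ω ∈ B) (hg : BddMeas B g) (r : ℕ) :
    BddMeas B fun v => ∫ x, g x ∂(chain ν f v r) := by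
  induction r generalizing g with
  | zero =>
    have : (fun v => ∫ x, g x ∂(chain ν f v 0)) = g := by
      ext v
      exact integral_dirac' g v hg.1.stronglyMeasurable
    rwa [this]
  | succ r ih =>
    simp_rw [integral_chain_succ hf hfB hg]
    exact ih (hg.integral_comp hf hfB r)

/-- The Markov property at time `s`: given the state `y`, the rest is a chain started at `y` with
time-shifted steps. It allows a random iterate to serve as comparator. -/
lemma integral_chain_add (hf : ∀ t, Measurable fun p : X × Ω => f t p.1 p.2)
    (hfB : ∀ t x ω, f t x ω ∈ B) (hg : BddMeas B g) (v : X) (s r : ℕ) :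
    ∫ x, g x ∂(chain ν f v (s + r))
      = ∫ y, ∫ x, g x ∂(chain ν (fun t => f (s + t)) y r) ∂(chain ν f v s) := by
  induction r generalizing g with
  | zero =>
    refine integral_congr_ae (Filter.Eventually.of_forall fun y => ?_)
    exact (integral_dirac' g y hg.1.stronglyMeasurable).symm
  | succ r ih =>
    rw [← add_assoc, integral_chain_succ hf hfB hg, ih (hg.integral_comp hf hfB _)]
    refine integral_congr_ae (Filter.Eventually.of_forall fun y => ?_)
    exact (integral_chain_succ (f := fun t => f (s + t)) (fun t => hf _) (fun t => hfB _) hg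
      y r).symm

/-- The standard telescoping estimate for stochastic gradient descent, from a one-step estimate. -/
lemma sum_chain_le (hf : ∀ t, Measurable fun p : X × Ω => f t p.1 p.2)
    (hB : MeasurableSet B) (hfB : ∀ t x ω, f t x ω ∈ B) {F D : X → ℝ} (hF : BddMeas B F)
    (hD : BddMeas B D) (hD0 : ∀ x, 0 ≤ D x) {η : ℕ → ℝ} {G c : ℝ}
    (hstep : ∀ t, ∀ x ∈ B, ∫ ω, D (f t x ω) ∂ν ≤ D x - 2 * η t * (F x - c) + η t ^ 2 * G ^ 2)
    {v : X} (hv : v ∈ B) (r : ℕ) :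
    ∑ j ∈ Finset.range r, 2 * η j * (∫ x, F x ∂(chain ν f v j) - c)
      ≤ D v + G ^ 2 * ∑ j ∈ Finset.range r, η j ^ 2 := by
  -- The expected final distance is kept on the left so that the induction closes; being
  -- nonnegative, it is dropped at the end.
  have key : ∀ r, ∑ j ∈ Finset.range r, 2 * η j * (∫ x, F x ∂(chain ν f v j) - c)
      + ∫ x, D x ∂(chain ν f v r) ≤ D v + G ^ 2 * ∑ j ∈ Finset.range r, η j ^ 2 := by
    intro r
    induction r with
    | zero =>
      have : ∫ x, D x ∂(chain ν f v 0) = D v := integral_dirac' D v hD.1.stronglyMeasurable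
      simp [this]
    | succ r ih =>
      have := isProbabilityMeasure_chain (ν := ν) hf v r
      have hae := ae_mem_chain (ν := ν) hf hB hfB hv r
      have hFi := hF.integrable hae
      have hDi := hD.integrable hae
      have hi1 : Integrable (fun x => 2 * η r * (F x - c)) (chain ν f v r) :=
        (hFi.sub (integrable_const c)).const_mul _
      have hi2 : Integrable (fun x => D x - 2 * η r * (F x - c)) (chain ν f v r) := hDi.sub hi1
      have h1 : ∫ x, D x ∂(chain ν f v (r + 1)) ≤ ∫ x, D x ∂(chain ν f v r)
          - 2 * η r * (∫ x, F x ∂(chain ν f v r) - c) + η r ^ 2 * G ^ 2 := by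
        rw [integral_chain_succ hf hfB hD]
        calc _ ≤ ∫ x, (D x - 2 * η r * (F x - c) + η r ^ 2 * G ^ 2) ∂(chain ν f v r) := by
              refine integral_mono_ae ((hD.integral_comp hf hfB r).integrable hae) ?_
                (hae.mono fun x hx => hstep r x hx)
              exact hi2.add (integrable_const _)
          _ = _ := by
              rw [integral_add hi2 (integrable_const _), integral_sub hDi hi1,
                integral_const_mul, integral_sub hFi (integrable_const c)]
              simp
      rw [Finset.sum_range_succ, Finset.sum_range_succ]
      linarith
  have := isProbabilityMeasure_chain (ν := ν) hf v r
  have h0 : 0 ≤ ∫ x, D x ∂(chain ν f v r) := integral_nonneg hD0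
  linarith [key r]

end Chain

/-! ### The last iterate -/

/-- The reduction of the last iterate to averages over suffixes, for a sequence indexed backwards
from the last iterate. -/
lemma last_le_average_add {e p R : ℕ → ℝ} {T : ℕ} (hT : 1 ≤ T)
    (he : ∀ j k, j ≤ k → k < T → e j ≤ e k) (hp : ∀ j, 0 ≤ p j)
    (hR : ∀ k, 1 ≤ k → k < T → ∑ j ∈ Finset.range (k + 1), e j * (p j - p k) ≤ R k) :
    e 0 * p 0 ≤ (∑ j ∈ Finset.range T, e j * p j) / T
      + ∑ k ∈ Finset.Ico 1 T, R k / (k * (k + 1)) := by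
  have key : ∀ k, 1 ≤ k → k ≤ T → e 0 * p 0 ≤ (∑ j ∈ Finset.range k, e j * p j) / k
      + ∑ i ∈ Finset.Ico 1 k, R i / (i * (i + 1)) := by
    intro k hk
    induction k, hk using Nat.le_induction with
    | base => simp
    | succ k hk ih =>
      intro hkT
      refine (ih (by omega)).trans ?_
      rw [Finset.sum_Ico_succ_top hk, ← add_assoc, add_right_comm]
      refine add_le_add_left ?_ _
      -- The weights grow backwards in time and `p k ≥ 0`, so `e j p j - e k p k ≤ e j (p j - p k)`.
      -- This bounds the increase caused by replacing the average of `k + 1` terms by that of the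
      -- first `k`.
      have h1 : ∑ j ∈ Finset.range (k + 1), (e j * p j - e k * p k) ≤ R k := by
        refine le_trans (Finset.sum_le_sum fun j hj => ?_) (hR k hk (by omega))
        have : e j ≤ e k := he j k (by simp at hj; omega) (by omega)
        nlinarith [hp k]
      rw [Finset.sum_sub_distrib, Finset.sum_const, Finset.card_range, nsmul_eq_mul] at h1
      rw [Finset.sum_range_succ] at h1 ⊢
      have hk0 : (0 : ℝ) < k := by exact_mod_cast hk
      set S := ∑ j ∈ Finset.range k, e j * p j
      push_cast at h1 ⊢
      have e1 : (S + e k * p k) / (k + 1) + R k / (k * (k + 1)) - S / k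
          = (k * (e k * p k) + R k - S) / (k * (k + 1)) := by
        field_simp
        ring
      have : 0 ≤ (k * (e k * p k) + R k - S) / (k * (k + 1)) :=
        div_nonneg (by linarith) (by positivity)
      linarith
  exact key T hT le_rfl

/-- Partial fractions, `1 / (k (T - k)) = (1 / k + 1 / (T - k)) / T`, and the reflection `k ↦ T - k`
reduce the sum to two harmonic sums. -/
lemma sum_suffix_le {T : ℕ} (hT : 1 ≤ T) :
    ∑ k ∈ Finset.Ico 1 T, (1 : ℝ) / (k * (T - k)) ≤ 2 * (1 + Real.log T) / T := by
  have hT0 : (0 : ℝ) < T := by exact_mod_cast hT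
  have hH : ∑ k ∈ Finset.Ico 1 T, (1 : ℝ) / k ≤ 1 + Real.log T := by
    have h1 := harmonic_le_one_add_log T
    refine le_trans ?_ h1
    rw [harmonic_eq_sum_Icc]
    push_cast
    simp_rw [one_div]
    exact Finset.sum_le_sum_of_subset_of_nonneg (fun k hk => by simp at hk ⊢; omega)
      fun _ _ _ => by positivity
  have h2 : ∑ k ∈ Finset.Ico 1 T, (1 : ℝ) / (T - k) = ∑ k ∈ Finset.Ico 1 T, (1 : ℝ) / k := by
    refine Finset.sum_bij' (fun k _ => T - k) (fun k _ => T - k) ?_ ?_ ?_ ?_ ?_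
    · intro k hk; simp at hk ⊢; omega
    · intro k hk; simp at hk ⊢; omega
    · intro k hk; simp at hk; omega
    · intro k hk; simp at hk; omega
    · intro k hk
      simp at hk
      rw [Nat.cast_sub hk.2.le]
  calc ∑ k ∈ Finset.Ico 1 T, (1 : ℝ) / (k * (T - k))
      = ∑ k ∈ Finset.Ico 1 T, (1 / k + 1 / (T - k)) / (T : ℝ) := by
        refine Finset.sum_congr rfl fun k hk => ?_
        simp at hk
        have h3 : (0 : ℝ) < k := by exact_mod_cast hk.1
        have h4 : (0 : ℝ) < T - k := by
          have : (k : ℝ) < T := by exact_mod_cast hk.2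
          linarith
        field_simp
        ring
    _ ≤ _ := by
        rw [← Finset.sum_div, Finset.sum_add_distrib, h2]
        gcongr
        linarith

section LastIterate

variable {X Ω : Type*} [MeasurableSpace X] [MeasurableSpace Ω] {ν : Measure Ω}
  [IsProbabilityMeasure ν] {f : ℕ → X → Ω → X} {B : Set X}

/-- Convergence of the last iterate of stochastic gradient descent with step sizes `2 / (G √t)`. -/
theorem integral_chain_last_le (hf : ∀ t, Measurable fun p : X × Ω => f t p.1 p.2)
    (hB : MeasurableSet B) (hfB : ∀ t x ω, f t x ω ∈ B) {F : X → ℝ} {D : X → X → ℝ}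
    (hF : BddMeas B F) (hF0 : ∀ x, 0 ≤ F x) (hD : ∀ v ∈ B, BddMeas B (D v))
    (hD0 : ∀ v x, 0 ≤ D v x) (hDv : ∀ v, D v v = 0) (hD4 : ∀ v ∈ B, ∀ x ∈ B, D v x ≤ 4)
    {η : ℕ → ℝ} {G : ℝ} (hG : 0 < G) (hη : ∀ t, η t = 2 / (G * √(t + 1)))
    (hstep : ∀ t, ∀ v ∈ B, ∀ x ∈ B,
      ∫ ω, D v (f t x ω) ∂ν ≤ D v x - 2 * η t * (F x - F v) + η t ^ 2 * G ^ 2)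
    {v₁ v₀ : X} (hv₁ : v₁ ∈ B) (hv₀ : v₀ ∈ B) (hF₀ : F v₀ = 0) {T : ℕ} (hT : 1 ≤ T) :
    ∫ x, F x ∂(chain ν f v₁ (T - 1)) ≤ G / √T * (4 + 3 * Real.log T) := by
  have hT0 : (0 : ℝ) < T := by exact_mod_cast hT
  have hlog : 0 ≤ Real.log T := Real.log_nonneg (by exact_mod_cast hT)
  have hη0 : ∀ t, 0 ≤ η t := fun t => by rw [hη]; positivity
  have hη2 : ∀ t, G ^ 2 * η t ^ 2 = 4 / (t + 1) := fun t => by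
    rw [hη, div_pow, mul_pow, Real.sq_sqrt (by positivity)]
    field_simp
    norm_num
  have hprob := fun t => isProbabilityMeasure_chain (ν := ν) hf v₁ t
  have hae := fun t => ae_mem_chain (ν := ν) hf hB hfB hv₁ t
  set a : ℕ → ℝ := fun t => ∫ x, F x ∂(chain ν f v₁ t) with ha
  have ha0 : ∀ t, 0 ≤ a t := fun t => integral_nonneg hF0
  -- The comparator is the zero-loss point `v₀`, at squared distance at most `4` from the start.
  have havg : ∑ t ∈ Finset.range T, η t * a t ≤ 2 + 2 * (1 + Real.log T) := by
    have h1 := sum_chain_le (c := 0) hf hB hfB hF (hD v₀ hv₀) (hD0 v₀) (η := η) (G := G)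
      (fun t x hx => by simpa [hF₀] using hstep t v₀ hv₀ x hx) hv₁ T
    have h2 : ∑ j ∈ Finset.range T, 2 * η j * (∫ x, F x ∂(chain ν f v₁ j) - 0)
        = 2 * ∑ t ∈ Finset.range T, η t * a t := by
      rw [Finset.mul_sum]
      exact Finset.sum_congr rfl fun j _ => by rw [ha]; ring
    have h3 : G ^ 2 * ∑ j ∈ Finset.range T, η j ^ 2 ≤ 4 * (1 + Real.log T) := by
      rw [Finset.mul_sum]
      simp_rw [hη2]
      have := harmonic_le_one_add_log T
      rw [harmonic] at this
      push_cast at this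
      simp_rw [div_eq_mul_inv]
      rw [← Finset.mul_sum]
      linarith
    have := hD4 v₀ hv₀ v₁ hv₁
    linarith
  -- Here the comparator is the iterate at time `s` itself. The restarted chain begins at distance
  -- zero from it, so only the sum of the squared steps remains; this is integrated over the law of
  -- that iterate.
  have hsuf : ∀ s r : ℕ, ∑ j ∈ Finset.range r, η (s + j) * (a (s + j) - a s)
      ≤ ∑ j ∈ Finset.range r, 2 / ((s : ℝ) + j + 1) := by
    intro s r
    have hbdd : ∀ j, BddMeas B fun y => ∫ x, F x ∂(chain ν (fun t => f (s + t)) y j) := fun j =>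
      bddMeas_integral_chain (fun t => hf _) (fun t => hfB _) hF j
    have h1 : ∀ y ∈ B, ∑ j ∈ Finset.range r,
        2 * η (s + j) * (∫ x, F x ∂(chain ν (fun t => f (s + t)) y j) - F y)
        ≤ G ^ 2 * ∑ j ∈ Finset.range r, η (s + j) ^ 2 := by
      intro y hy
      have := sum_chain_le (f := fun t => f (s + t)) (fun t => hf _) hB (fun t => hfB _) hF
        (hD y hy) (hD0 y) (η := fun t => η (s + t)) (G := G) (c := F y)
        (fun t x hx => hstep (s + t) y hy x hx) hy r
      rwa [hDv, zero_add] at this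
    have hint : ∀ j, Integrable (fun y => 2 * η (s + j) *
        (∫ x, F x ∂(chain ν (fun t => f (s + t)) y j) - F y)) (chain ν f v₁ s) := fun j =>
      (((hbdd j).integrable (hae s)).sub (hF.integrable (hae s))).const_mul _
    have h2 := integral_mono_ae (integrable_finsetSum (Finset.range r) fun j _ => hint j)
      (integrable_const _) ((hae s).mono h1)
    rw [integral_finsetSum _ fun j _ => hint j, integral_const] at h2
    simp only [probReal_univ, one_smul] at h2
    have h3 : ∀ j, ∫ y, 2 * η (s + j) * (∫ x, F x ∂(chain ν (fun t => f (s + t)) y j) - F y)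
        ∂(chain ν f v₁ s) = 2 * (η (s + j) * (a (s + j) - a s)) := by
      intro j
      rw [integral_const_mul, integral_sub ((hbdd j).integrable (hae s)) (hF.integrable (hae s)),
        ← integral_chain_add hf hfB hF]
      ring
    simp_rw [h3] at h2
    rw [← Finset.mul_sum, Finset.mul_sum (Finset.range r) (fun j => η (s + j) ^ 2)] at h2
    simp_rw [hη2] at h2
    have h4 : ∑ j ∈ Finset.range r, (4 : ℝ) / (((s + j : ℕ) : ℝ) + 1)
        = 2 * ∑ j ∈ Finset.range r, 2 / ((s : ℝ) + j + 1) := by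
      rw [Finset.mul_sum]
      refine Finset.sum_congr rfl fun j _ => ?_
      push_cast
      ring
    rw [h4] at h2
    linarith
  -- The suffix bound with `s = T - 1 - k` has `k + 1` terms, each at most `2 / (T - k)`; this is `R
  -- k`.
  have hlast := last_le_average_add (e := fun j => η (T - 1 - j)) (p := fun j => a (T - 1 - j))
    (R := fun k => 2 * (k + 1) / ((T : ℝ) - k)) hT
    (by
      intro j k hjk hk
      simp only [hη]
      have : ((T - 1 - k : ℕ) : ℝ) ≤ ((T - 1 - j : ℕ) : ℝ) := by
        exact_mod_cast Nat.sub_le_sub_left hjk _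
      gcongr)
    (fun j => ha0 _)
    (by
      intro k hk1 hk
      have h1 := hsuf (T - 1 - k) (k + 1)
      rw [← Finset.sum_range_reflect] at h1
      have hTk : ((T - 1 - k : ℕ) : ℝ) = T - 1 - k := by
        rw [Nat.cast_sub (by omega), Nat.cast_sub (by omega)]
        simp
      have hTk0 : (0 : ℝ) < T - k := by
        have : (k : ℝ) < T := by exact_mod_cast hk
        linarith
      calc _ = ∑ j ∈ Finset.range (k + 1), η (T - 1 - k + (k + 1 - 1 - j))
            * (a (T - 1 - k + (k + 1 - 1 - j)) - a (T - 1 - k)) := by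
            refine Finset.sum_congr rfl fun j hj => ?_
            simp at hj
            have : T - 1 - k + (k + 1 - 1 - j) = T - 1 - j := by omega
            rw [this]
        _ ≤ _ := h1
        _ ≤ ∑ j ∈ Finset.range (k + 1), 2 / ((T : ℝ) - k) := by
            refine Finset.sum_le_sum fun j _ => ?_
            rw [hTk]
            refine div_le_div_of_nonneg_left (by norm_num) hTk0 ?_
            have : (0 : ℝ) ≤ j := by positivity
            linarith
        _ = _ := by
            rw [Finset.sum_const, Finset.card_range, nsmul_eq_mul]
            push_cast
            ring)
  simp only [Nat.sub_zero] at hlast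
  have h5 : ∑ j ∈ Finset.range T, η (T - 1 - j) * a (T - 1 - j) = ∑ t ∈ Finset.range T, η t * a t :=
    Finset.sum_range_reflect (fun t => η t * a t) T
  have h6 : ∑ k ∈ Finset.Ico 1 T, 2 * ((k : ℝ) + 1) / ((T : ℝ) - k) / (k * (k + 1))
      = 2 * ∑ k ∈ Finset.Ico 1 T, (1 : ℝ) / (k * (T - k)) := by
    rw [Finset.mul_sum]
    refine Finset.sum_congr rfl fun k hk => ?_
    simp at hk
    have h3 : (0 : ℝ) < k := by exact_mod_cast hk.1
    have h4 : (0 : ℝ) < T - k := by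
      have : (k : ℝ) < T := by exact_mod_cast hk.2
      linarith
    field_simp
  rw [h5, h6] at hlast
  have h7 := sum_suffix_le hT
  have h8 : (∑ t ∈ Finset.range T, η t * a t) / T ≤ (2 + 2 * (1 + Real.log T)) / T := by gcongr
  have h9 : η (T - 1) = 2 / (G * √T) := by
    rw [hη, Nat.cast_sub hT]
    simp
  rw [h9] at hlast
  have hs : 0 < √(T : ℝ) := Real.sqrt_pos.2 hT0
  have h10 : 2 / (G * √T) * a (T - 1) ≤ (8 + 6 * Real.log T) / T := by
    refine hlast.trans ?_
    have : (8 + 6 * Real.log T) / T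
        = (2 + 2 * (1 + Real.log T)) / T + 2 * (2 * (1 + Real.log T) / T) := by ring
    linarith
  have h11 : a (T - 1) = (2 / (G * √T) * a (T - 1)) * (G * √T / 2) := by
    field_simp
  change a (T - 1) ≤ _
  rw [h11]
  calc _ ≤ (8 + 6 * Real.log T) / T * (G * √T / 2) := by gcongr
    _ = (8 + 6 * Real.log T) / (√T * √T) * (G * √T / 2) := by rw [Real.mul_self_sqrt hT0.le]
    _ = _ := by
      field_simp
      ring

end LastIterate

/-! ### Noisy stochastic gradient descent -/

lemma integral_uniformOn_univ {Ω : Type*} [MeasurableSpace Ω] [MeasurableSingletonClass Ω]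
    [Fintype Ω] [Nonempty Ω] (h : Ω → ℝ) :
    ∫ x, h x ∂(uniformOn (Set.univ : Set Ω)) = (∑ x, h x) / Fintype.card Ω := by
  have := isProbabilityMeasure_uniformOn (Set.finite_univ (α := Ω)) Set.univ_nonempty
  rw [integral_fintype (Integrable.of_finite)]
  simp only [Measure.real, uniformOn_univ, Measure.count_singleton, ENNReal.toReal_div,
    smul_eq_mul, Finset.sum_div]
  refine Finset.sum_congr rfl fun x _ => ?_
  simp
  ring

section Gaussian

variable {m : ℕ}

lemma integrable_inner_stdGaussian (c : E m) :
    Integrable (fun b => inner ℝ c b) (stdGaussian (E m)) :=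
  (IsGaussian.integrable_dual _ (innerSL ℝ c))

lemma integral_inner_stdGaussian (c : E m) : ∫ b, inner ℝ c b ∂(stdGaussian (E m)) = 0 :=
  integral_strongDual_stdGaussian (innerSL ℝ c)

lemma integrable_norm_sq_stdGaussian : Integrable (fun b => ‖b‖ ^ 2) (stdGaussian (E m)) :=
  (IsGaussian.memLp_two_id (μ := stdGaussian (E m))).integrable_norm_pow (by norm_num)

lemma integral_norm_sq_stdGaussian : ∫ b, ‖b‖ ^ 2 ∂(stdGaussian (E m)) = m := by
  have hmem : ∀ i, MemLp (fun b : E m => b i) 2 (stdGaussian (E m)) := fun i =>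
    IsGaussian.memLp_dual _ (EuclideanSpace.proj i) 2 (by simp)
  simp_rw [EuclideanSpace.real_norm_sq_eq]
  rw [integral_finsetSum _ fun i _ => (hmem i).integrable_sq]
  have h : ∀ i : Fin m, ∫ b : E m, b i ^ 2 ∂(stdGaussian (E m)) = 1 := by
    intro i
    have h0 : ∫ b : E m, b i ∂(stdGaussian (E m)) = 0 :=
      integral_strongDual_stdGaussian (EuclideanSpace.proj i)
    have h1 : Var[fun b : E m => b i; stdGaussian (E m)] = 1 := by
      rw [← multivariateGaussian_zero_one, variance_eval_multivariateGaussian Matrix.PosSemidef.one]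
      simp
    rw [variance_of_integral_eq_zero (hmem i).aemeasurable h0] at h1
    exact h1
  simp [h]

end Gaussian

section NoiseGD

variable {m n : ℕ}

/-- The noise of one step: a uniform data point and a standard Gaussian. -/
noncomputable abbrev stepNoise (m n : ℕ) : Measure (Fin n × E m) :=
  (uniformOn (Set.univ : Set (Fin n))).prod (stdGaussian (E m))

lemma isProbabilityMeasure_stepNoise (hn : 1 ≤ n) : IsProbabilityMeasure (stepNoise m n) := by
  have : Nonempty (Fin n) := ⟨⟨0, hn⟩⟩
  have := isProbabilityMeasure_uniformOn (Set.finite_univ (α := Fin n)) Set.univ_nonempty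
  infer_instance

lemma measurable_noiseGDStep (γ ε δ : ℝ) (t : ℕ) {Ω : Type*} [MeasurableSpace Ω]
    {T : Ω → Fin n → Example m} {w : Ω → E m} {i : Ω → Fin n} {b : Ω → E m} (hT : Measurable T)
    (hw : Measurable w) (hi : Measurable i) (hb : Measurable b) :
    Measurable fun ω => noiseGDStep γ ε δ (T ω) t (w ω) (i ω) (b ω) := by
  unfold noiseGDStep
  refine measurable_projBall.comp ?_
  have h1 : Measurable fun ω => T ω (i ω) := by
    have : Measurable fun q : (Fin n → Example m) × Fin n => q.1 q.2 :=
      measurable_from_prod_countable_left fun i => measurable_pi_apply i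
    exact this.comp (hT.prodMk hi)
  have h2 := measurable_lossGrad γ hw h1
  fun_prop

lemma measurable_noiseGDStep_prod (γ ε δ : ℝ) (T : Fin n → Example m) (t : ℕ) :
    Measurable fun p : E m × Fin n × E m => noiseGDStep γ ε δ T t p.1 p.2.1 p.2.2 :=
  measurable_noiseGDStep γ ε δ t measurable_const (by fun_prop) (by fun_prop) (by fun_prop)

lemma noiseGDIterate_eq_chain (γ ε δ : ℝ) (w₁ : E m) (T : Fin n → Example m) (s : ℕ) :
    noiseGDIterate γ ε δ w₁ T s
      = chain (stepNoise m n) (fun t w p => noiseGDStep γ ε δ T (t + 1) w p.1 p.2) w₁ s := by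
  induction s with
  | zero => rfl
  | succ s ih => rw [noiseGDIterate, ih, chain]

/-- The bound `√(n² L² + m σ²)` on the root mean square of the noisy gradients. -/
noncomputable def gradBound (m n : ℕ) (γ ε δ : ℝ) : ℝ :=
  √(n ^ 2 * lossLip γ ^ 2 + m * noiseSD n γ ε δ ^ 2)

lemma gradBound_pos (hn : 1 ≤ n) {γ : ℝ} (hγ : 0 < γ) (ε δ : ℝ) : 0 < gradBound m n γ ε δ := by
  have hL : 0 < lossLip γ := by unfold lossLip; positivity
  have : (0 : ℝ) < n := by exact_mod_cast hn
  unfold gradBound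
  positivity

lemma gradBound_sq (m n : ℕ) (γ ε δ : ℝ) : gradBound m n γ ε δ ^ 2
    = n ^ 2 * lossLip γ ^ 2 + m * noiseSD n γ ε δ ^ 2 := Real.sq_sqrt (by positivity)

/-- Projecting does not increase the distance to `v`. After expanding the square, the terms linear
in the Gaussian have mean zero, its squared norm has mean `m`, and `n` times the gradient at a
uniform data point averages to a subgradient of the total loss. -/
lemma integral_norm_noiseGDStep_sub_sq_le (hn : 1 ≤ n) {γ : ℝ} (hγ : 0 < γ) (ε δ : ℝ)
    {T : Fin n → Example m} (hT : ∀ i, ‖(T i).1‖ ≤ 1) (t : ℕ) (x : E m) {v : E m} (hv : ‖v‖ ≤ 1) :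
    ∫ p, ‖noiseGDStep γ ε δ T t x p.1 p.2 - v‖ ^ 2 ∂(stepNoise m n)
      ≤ ‖x - v‖ ^ 2 - 2 * learningRate m n γ ε δ t * (totalLoss γ x T - totalLoss γ v T)
        + learningRate m n γ ε δ t ^ 2 * gradBound m n γ ε δ ^ 2 := by
  have : Nonempty (Fin n) := ⟨⟨0, hn⟩⟩
  have := isProbabilityMeasure_uniformOn (Set.finite_univ (α := Fin n)) Set.univ_nonempty
  have hn0 : (0 : ℝ) < n := by exact_mod_cast hn
  have hmeas : Measurable fun p : Fin n × E m => noiseGDStep γ ε δ T t x p.1 p.2 :=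
    measurable_noiseGDStep γ ε δ t measurable_const measurable_const (by fun_prop) (by fun_prop)
  have hbd : ∀ p : Fin n × E m, ‖‖noiseGDStep γ ε δ T t x p.1 p.2 - v‖ ^ 2‖ ≤ 4 := by
    intro p
    rw [Real.norm_of_nonneg (by positivity)]
    have : ‖noiseGDStep γ ε δ T t x p.1 p.2 - v‖ ≤ 2 :=
      (norm_sub_le _ _).trans (by
        linarith [show ‖noiseGDStep γ ε δ T t x p.1 p.2‖ ≤ 1 from norm_projBall_le _])
    nlinarith [norm_nonneg (noiseGDStep γ ε δ T t x p.1 p.2 - v)]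
  set η := learningRate m n γ ε δ t with hη
  have hη0 : 0 ≤ η := by rw [hη, learningRate]; positivity
  set σ := noiseSD n γ ε δ
  have hint : Integrable (fun p : Fin n × E m => ‖noiseGDStep γ ε δ T t x p.1 p.2 - v‖ ^ 2)
      (stepNoise m n) :=
    Integrable.of_bound (by fun_prop) 4 (Filter.Eventually.of_forall hbd)
  rw [integral_prod _ hint, integral_uniformOn_univ, Fintype.card_fin]
  have hi : ∀ i, ∫ b, ‖noiseGDStep γ ε δ T t x i b - v‖ ^ 2 ∂(stdGaussian (E m))
      ≤ ‖x - v‖ ^ 2 - 2 * η * (n * inner ℝ (lossGrad γ x (T i)) (x - v))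
        + η ^ 2 * gradBound m n γ ε δ ^ 2 := by
    intro i
    set g := lossGrad γ x (T i) with hg
    have hgL : ‖g‖ ≤ lossLip γ := norm_lossGrad_le hγ x (hT i)
    have hpt : ∀ b, ‖noiseGDStep γ ε δ T t x i b - v‖ ^ 2 ≤
        (‖x - v‖ ^ 2 - 2 * η * (n * inner ℝ g (x - v)) + η ^ 2 * (n ^ 2 * lossLip γ ^ 2))
          + (inner ℝ ((2 * η ^ 2 * n * σ) • g - (2 * η * σ) • (x - v)) b
          + (η ^ 2 * σ ^ 2) * ‖b‖ ^ 2) := by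
      intro b
      have h1 : ‖noiseGDStep γ ε δ T t x i b - v‖ ≤ ‖x - η • ((n : ℝ) • g + σ • b) - v‖ :=
        norm_projBall_sub_le _ hv
      have h2 : x - η • ((n : ℝ) • g + σ • b) - v = (x - v) - η • ((n : ℝ) • g + σ • b) := by abel
      have h3 : ‖g‖ ^ 2 ≤ lossLip γ ^ 2 := by gcongr
      have h4 : η ^ 2 * (n ^ 2 * ‖g‖ ^ 2) ≤ η ^ 2 * (n ^ 2 * lossLip γ ^ 2) := by gcongr
      refine (pow_le_pow_left₀ (norm_nonneg _) h1 2).trans ?_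
      have h5 : inner ℝ ((2 * η ^ 2 * n * σ) • g - (2 * η * σ) • (x - v)) b
          = (2 * η ^ 2 * n * σ) * inner ℝ g b - (2 * η * σ) * inner ℝ (x - v) b := by
        rw [inner_sub_left, real_inner_smul_left, real_inner_smul_left]
      rw [h2, h5]
      generalize x - v = u
      rw [norm_sub_sq_real, norm_smul, mul_pow, norm_add_sq_real, norm_smul, norm_smul, mul_pow,
        mul_pow, inner_smul_right, inner_add_right, inner_smul_right, inner_smul_right,
        real_inner_smul_left, inner_smul_right, Real.norm_eq_abs, Real.norm_eq_abs,
        Real.norm_eq_abs, sq_abs, sq_abs, sq_abs, real_inner_comm g u]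
      linarith
    have hib : Integrable (fun b => inner ℝ ((2 * η ^ 2 * n * σ) • g - (2 * η * σ) • (x - v)) b
        + (η ^ 2 * σ ^ 2) * ‖b‖ ^ 2) (stdGaussian (E m)) :=
      (integrable_inner_stdGaussian _).add (integrable_norm_sq_stdGaussian.const_mul _)
    have hil : Integrable (fun b => ‖noiseGDStep γ ε δ T t x i b - v‖ ^ 2) (stdGaussian (E m)) := by
      refine Integrable.of_bound ?_ 4 (Filter.Eventually.of_forall fun b => hbd (i, b))
      have : Measurable fun b => noiseGDStep γ ε δ T t x i b :=
        measurable_noiseGDStep γ ε δ t measurable_const measurable_const measurable_const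
          measurable_id
      fun_prop
    refine (integral_mono hil ((integrable_const _).add hib) hpt).trans (le_of_eq ?_)
    simp only [Pi.add_apply]
    rw [integral_add (integrable_const _) hib, integral_add (integrable_inner_stdGaussian _)
      (integrable_norm_sq_stdGaussian.const_mul _), integral_inner_stdGaussian, integral_const_mul,
      integral_norm_sq_stdGaussian, gradBound_sq]
    simp
    ring
  calc _ ≤ (∑ i, (‖x - v‖ ^ 2 - 2 * η * (n * inner ℝ (lossGrad γ x (T i)) (x - v))
        + η ^ 2 * gradBound m n γ ε δ ^ 2)) / (n : ℝ) := by
        gcongr with i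
        exact hi i
    _ = ‖x - v‖ ^ 2 - 2 * η * ∑ i, inner ℝ (lossGrad γ x (T i)) (x - v)
        + η ^ 2 * gradBound m n γ ε δ ^ 2 := by
        rw [Finset.sum_add_distrib, Finset.sum_sub_distrib, ← Finset.mul_sum, ← Finset.mul_sum]
        simp
        field_simp
    _ ≤ _ := by
        have : totalLoss γ x T - totalLoss γ v T ≤ ∑ i, inner ℝ (lossGrad γ x (T i)) (x - v) := by
          rw [totalLoss, totalLoss, ← Finset.sum_sub_distrib]
          exact Finset.sum_le_sum fun i _ => loss_sub_le_inner hγ x v (T i)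
        gcongr

lemma totalLoss_nonneg {γ : ℝ} (hγ : 0 < γ) (w : E m) (T : Fin n → Example m) :
    0 ≤ totalLoss γ w T := Finset.sum_nonneg fun i _ => loss_nonneg hγ w (T i)

lemma totalLoss_le {γ : ℝ} (hγ : 0 < γ) (hγ1 : γ ≤ 1) {w : E m} (hw : ‖w‖ ≤ 1)
    {T : Fin n → Example m} (hT : ∀ i, ‖(T i).1‖ ≤ 1) : totalLoss γ w T ≤ n * (3 / γ) := by
  refine (Finset.sum_le_sum fun i _ => loss_le hγ hγ1 hw (hT i)).trans ?_
  simp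

lemma measurable_totalLoss (γ : ℝ) {Ω : Type*} [MeasurableSpace Ω] {w : Ω → E m}
    {T : Ω → Fin n → Example m} (hw : Measurable w) (hT : Measurable T) :
    Measurable fun ω => totalLoss γ (w ω) (T ω) :=
  Finset.measurable_sum _ fun _ _ => measurable_loss γ hw (by fun_prop)

lemma ae_norm_le_noiseGD (γ ε δ : ℝ) {w₁ : E m} (hw₁ : ‖w₁‖ ≤ 1) (T : Fin n → Example m) :
    ∀ᵐ w ∂(noiseGD γ ε δ w₁ T), ‖w‖ ≤ 1 := by
  rw [noiseGD, noiseGDIterate_eq_chain]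
  exact ae_mem_chain (B := {w | ‖w‖ ≤ 1}) (fun t => measurable_noiseGDStep_prod γ ε δ T (t + 1))
    (measurableSet_le (by fun_prop) (by fun_prop)) (fun t x ω => norm_projBall_le _) hw₁ _

lemma isProbabilityMeasure_noiseGD (hn : 1 ≤ n) (γ ε δ : ℝ) (w₁ : E m) (T : Fin n → Example m) :
    IsProbabilityMeasure (noiseGD γ ε δ w₁ T) := by
  have := isProbabilityMeasure_stepNoise (m := m) hn
  rw [noiseGD, noiseGDIterate_eq_chain]
  exact isProbabilityMeasure_chain (fun t => measurable_noiseGDStep_prod γ ε δ T (t + 1)) _ _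

/-- The expected total loss of the last iterate of noisy gradient descent, if some point of the ball
has loss zero. -/
theorem integral_totalLoss_noiseGD_le (hn : 1 ≤ n) {γ : ℝ} (hγ : 0 < γ) (hγ1 : γ ≤ 1) (ε δ : ℝ)
    {w₁ v₀ : E m} (hw₁ : ‖w₁‖ ≤ 1) (hv₀ : ‖v₀‖ ≤ 1) {T : Fin n → Example m}
    (hT : ∀ i, ‖(T i).1‖ ≤ 1) (h0 : totalLoss γ v₀ T = 0) :
    ∫ w, totalLoss γ w T ∂(noiseGD γ ε δ w₁ T)
      ≤ gradBound m n γ ε δ / n * (4 + 6 * Real.log n) := by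
  have := isProbabilityMeasure_stepNoise (m := m) hn
  rw [noiseGD, noiseGDIterate_eq_chain]
  have hTm : Measurable fun w => totalLoss γ w T :=
    measurable_totalLoss γ measurable_id measurable_const
  -- The chain is indexed from `0` and the step sizes from `1`, hence the shift `t + 1`; the output
  -- after `n ^ 2 - 1` steps is the last of `T = n ^ 2` iterates.
  have h := integral_chain_last_le (ν := stepNoise m n) (B := {w : E m | ‖w‖ ≤ 1})
    (f := fun t w p => noiseGDStep γ ε δ T (t + 1) w p.1 p.2) (F := fun w => totalLoss γ w T)
    (D := fun v x => ‖x - v‖ ^ 2) (η := fun t => learningRate m n γ ε δ (t + 1))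
    (G := gradBound m n γ ε δ)
    (fun t => measurable_noiseGDStep_prod γ ε δ T (t + 1))
    (measurableSet_le (by fun_prop) (by fun_prop)) (fun t x ω => norm_projBall_le _)
    ⟨hTm, n * (3 / γ), fun w hw => by
      rw [abs_of_nonneg (totalLoss_nonneg hγ _ _)]
      exact totalLoss_le hγ hγ1 hw hT⟩
    (fun w => totalLoss_nonneg hγ w T)
    (fun v hv => ⟨by fun_prop, 4, fun x hx => by
      rw [abs_of_nonneg (by positivity)]
      have : ‖x - v‖ ≤ 2 := (norm_sub_le _ _).trans (by linarith [hv.out, hx.out])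
      nlinarith [norm_nonneg (x - v)]⟩)
    (fun v x => by positivity) (fun v => by simp)
    (fun v hv x hx => by
      have : ‖x - v‖ ≤ 2 := (norm_sub_le _ _).trans (by linarith [hv.out, hx.out])
      nlinarith [norm_nonneg (x - v)])
    (gradBound_pos hn hγ ε δ)
    (fun t => by
      rw [learningRate, Real.sqrt_mul (by positivity), ← gradBound, mul_comm]
      push_cast
      rfl)
    (fun t v hv x hx => integral_norm_noiseGDStep_sub_sq_le hn hγ ε δ hT (t + 1) x hv)
    hw₁ hv₀ h0 (T := n ^ 2) (Nat.one_le_pow _ _ hn)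
  refine h.trans (le_of_eq ?_)
  rw [Nat.cast_pow, Real.sqrt_sq (by positivity), Real.log_pow]
  push_cast
  ring

end NoiseGD

/-! ### The exponential mechanism -/

section ExpMechanism

variable {n : ℕ} {Z O : Type}

lemma sensitivity_nonneg (𝒵 : Set Z) (u : (Fin n → Z) → O → ℝ) : 0 ≤ sensitivity 𝒵 u := by
  refine Real.sSup_nonneg ?_
  rintro r ⟨o, S, S', -, -, -, rfl⟩
  exact abs_nonneg _

lemma expWeight_pos (ε : ℝ) (𝒵 : Set Z) (u : (Fin n → Z) → O → ℝ) (S : Fin n → Z) (o : O) :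
    0 < expWeight ε 𝒵 u S o := Real.exp_pos _

variable [Fintype O] [MeasurableSpace O]

lemma isProbabilityMeasure_expMechanism [Nonempty O] (ε : ℝ) (𝒵 : Set Z)
    (u : (Fin n → Z) → O → ℝ) (S : Fin n → Z) :
    IsProbabilityMeasure (expMechanism ε 𝒵 u S) := by
  have h0 : 0 < ∑ o, expWeight ε 𝒵 u S o :=
    Finset.sum_pos (fun o _ => expWeight_pos ε 𝒵 u S o) Finset.univ_nonempty
  refine ⟨?_⟩
  simp only [expMechanism, Measure.coe_finsetSum, Measure.coe_smul, Finset.sum_apply,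
    Pi.smul_apply, measure_univ, smul_eq_mul, mul_one]
  rw [← ENNReal.ofReal_sum_of_nonneg fun o _ => div_nonneg (expWeight_pos ε 𝒵 u S o).le h0.le,
    ← Finset.sum_div, div_self h0.ne', ENNReal.ofReal_one]

open Classical in
lemma expMechanism_map_apply {X : Type*} [MeasurableSpace X] (ε : ℝ) (𝒵 : Set Z)
    (u : (Fin n → Z) → O → ℝ) (S : Fin n → Z) {W : O → X} (hW : Measurable W) {s : Set X}
    (hs : MeasurableSet s) : (expMechanism ε 𝒵 u S).map W s
      = ∑ o, ENNReal.ofReal (expWeight ε 𝒵 u S o / ∑ o', expWeight ε 𝒵 u S o')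
        * s.indicator 1 (W o) := by
  rw [Measure.map_apply hW hs]
  simp only [expMechanism, Measure.coe_finsetSum, Measure.coe_smul, Finset.sum_apply,
    Pi.smul_apply, smul_eq_mul]
  refine Finset.sum_congr rfl fun o _ => ?_
  rw [Measure.dirac_apply' _ (hW hs)]
  rfl

/-- The exponential mechanism rarely selects an element whose cost `f` is far from optimal. -/
lemma expMechanism_map_le {X : Type*} [MeasurableSpace X] {ε : ℝ} (hε : 0 < ε) (𝒵 : Set Z)
    (u : (Fin n → Z) → O → ℝ) (S : Fin n → Z) {W : O → X} (hW : Measurable W) {f : X → ℝ}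
    (hf : Measurable f) (hu : ∀ o, u S o = -f (W o)) {Δ p b : ℝ} (hp : 0 < p)
    (hΔ : sensitivity 𝒵 u ≤ Δ)
    (h0 : sensitivity 𝒵 u = 0 → ∀ o o', f (W o) = f (W o')) (hpk : p ≤ Fintype.card O)
    (hb : ∃ o, f (W o) ≤ b) :
    (expMechanism ε 𝒵 u S).map W {x | b + 2 * Δ * Real.log (Fintype.card O / p) / ε < f x}
      ≤ ENNReal.ofReal p := by
  obtain ⟨o₀, ho₀⟩ := hb
  have hs0 := sensitivity_nonneg 𝒵 u
  have hk : 0 < (Fintype.card O : ℝ) := hp.trans_le hpk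
  have hlog : 0 ≤ Real.log (Fintype.card O / p) := Real.log_nonneg (by rwa [one_le_div hp])
  have hset : MeasurableSet {x | b + 2 * Δ * Real.log (Fintype.card O / p) / ε < f x} :=
    measurableSet_lt measurable_const hf
  rw [expMechanism_map_apply ε 𝒵 u S hW hset]
  have hterm : ∀ o, ENNReal.ofReal (expWeight ε 𝒵 u S o / ∑ o', expWeight ε 𝒵 u S o')
      * {x | b + 2 * Δ * Real.log (Fintype.card O / p) / ε < f x}.indicator 1 (W o)
      ≤ ENNReal.ofReal (p / Fintype.card O) := by
    intro o
    by_cases ho : b + 2 * Δ * Real.log (Fintype.card O / p) / ε < f (W o)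
    · rw [Set.indicator_of_mem (by exact ho), Pi.one_apply, mul_one]
      refine ENNReal.ofReal_le_ofReal ?_
      have hlt : f (W o₀) < f (W o) := by
        have : 0 ≤ 2 * Δ * Real.log (Fintype.card O / p) / ε := by
          have := hs0.trans hΔ
          positivity
        linarith
      -- At sensitivity zero the exponent is a division by zero, so the selection is uniform; `h0`
      -- then says that all costs agree, and no element is bad.
      have hpos : 0 < sensitivity 𝒵 u :=
        lt_of_le_of_ne hs0 fun h => hlt.ne (h0 h.symm _ _)
      -- Bounding the normalizer below by the weight of the good element `o₀` alone turns the
      -- probability of `o` into the exponential of a cost gap.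
      have hle : expWeight ε 𝒵 u S o₀ ≤ ∑ o', expWeight ε 𝒵 u S o' :=
        Finset.single_le_sum (fun o _ => (expWeight_pos ε 𝒵 u S o).le) (Finset.mem_univ o₀)
      refine (div_le_div_of_nonneg_left (expWeight_pos _ _ _ _ _).le (expWeight_pos _ _ _ _ _)
        hle).trans ?_
      rw [expWeight, expWeight, ← Real.exp_sub, hu, hu]
      have hL : p / Fintype.card O = Real.exp (-Real.log (Fintype.card O / p)) := by
        rw [Real.exp_neg, Real.exp_log (by positivity), inv_div]
      rw [hL]
      refine Real.exp_le_exp.2 ?_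
      rw [← sub_div, div_le_iff₀ (by positivity)]
      have h1 : sensitivity 𝒵 u * Real.log (Fintype.card O / p)
          ≤ Δ * Real.log (Fintype.card O / p) := by gcongr
      have h2 : 2 * Δ * Real.log (Fintype.card O / p) < ε * (f (W o) - f (W o₀)) := by
        rw [← div_lt_iff₀' hε]
        linarith
      nlinarith
    · rw [Set.indicator_of_notMem (by exact ho), mul_zero]
      exact zero_le
  refine (Finset.sum_le_sum fun o _ => hterm o).trans (le_of_eq ?_)
  rw [Finset.sum_const, Finset.card_univ, nsmul_eq_mul, ← ENNReal.ofReal_natCast,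
    ← ENNReal.ofReal_mul hk.le]
  congr 1
  field_simp

end ExpMechanism

/-! ### The sensitivity of the total loss -/

section LossSensitivity

variable {m n : ℕ} {O : Type}

lemma totalLoss_sub_of_forall_ne {γ : ℝ} (w : E m) {S S' : Fin n → Example m} {i : Fin n}
    (h : ∀ j, j ≠ i → S j = S' j) :
    totalLoss γ w S - totalLoss γ w S' = loss γ w (S i) - loss γ w (S' i) := by
  rw [totalLoss, totalLoss, ← Finset.sum_sub_distrib]
  exact Finset.sum_eq_single i (fun j _ hj => by rw [h j hj, sub_self]) (by simp)

lemma sensitivity_totalLoss_le {γ : ℝ} (hγ : 0 < γ) (hγ1 : γ ≤ 1) {W : O → E m}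
    (hW : ∀ o, ‖W o‖ ≤ 1) :
    sensitivity {z : Example m | ‖z.1‖ ≤ 1} (fun (T : Fin n → Example m) o => -totalLoss γ (W o) T)
      ≤ 3 / γ := by
  refine Real.sSup_le ?_ (by positivity)
  rintro r ⟨o, S, S', hS, hS', ⟨i, hi⟩, rfl⟩
  rw [neg_sub_neg, abs_sub_comm, totalLoss_sub_of_forall_ne (W o) hi]
  exact abs_sub_le_of_nonneg_of_le (loss_nonneg hγ _ _) (loss_le hγ hγ1 (hW o) (hS i))
    (loss_nonneg hγ _ _) (loss_le hγ hγ1 (hW o) (hS' i))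

/-- A crude bound valid for every `w`, inside the ball or not. It makes the supremum in the
sensitivity genuine for all `W`, as measurability in `W` requires. -/
lemma abs_totalLoss_sub_le {γ : ℝ} (hγ : 0 < γ) (w : E m) {S S' : Fin n → Example m}
    (hS : ∀ i, ‖(S i).1‖ ≤ 1) (hS' : ∀ i, ‖(S' i).1‖ ≤ 1) :
    |totalLoss γ w S - totalLoss γ w S'| ≤ n * (2 + ‖w‖ / (86 * γ / 100)) := by
  have h : ∀ z : Example m, ‖z.1‖ ≤ 1 → loss γ w z ≤ 2 + ‖w‖ / (86 * γ / 100) := by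
    intro z hz
    rw [loss_eq_max hγ]
    refine max_le (by positivity) ?_
    have h1 : -‖w‖ ≤ margin w z := by
      have := (abs_le.1 (abs_margin_le w z)).1
      nlinarith [norm_nonneg w]
    have h2 : -(‖w‖ / (86 * γ / 100)) ≤ margin w z / (86 * γ / 100) := by
      rw [← neg_div]
      gcongr
    linarith
  have h2 : ∀ S : Fin n → Example m, (∀ i, ‖(S i).1‖ ≤ 1) →
      totalLoss γ w S ≤ n * (2 + ‖w‖ / (86 * γ / 100)) := by
    intro S hS
    refine (Finset.sum_le_sum fun i _ => h (S i) (hS i)).trans (le_of_eq ?_)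
    rw [Finset.sum_const, Finset.card_univ, Fintype.card_fin, nsmul_eq_mul]
  exact abs_sub_le_of_nonneg_of_le (totalLoss_nonneg hγ _ _) (h2 S hS) (totalLoss_nonneg hγ _ _)
    (h2 S' hS')

lemma le_sensitivity_totalLoss [Finite O] {γ : ℝ} (hγ : 0 < γ) (W : O → E m) (o : O)
    {S S' : Fin n → Example m} (hS : ∀ i, ‖(S i).1‖ ≤ 1) (hS' : ∀ i, ‖(S' i).1‖ ≤ 1)
    (h : Neighbors S S') : |totalLoss γ (W o) S - totalLoss γ (W o) S'| ≤
    sensitivity {z : Example m | ‖z.1‖ ≤ 1}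
      (fun (T : Fin n → Example m) o => -totalLoss γ (W o) T) := by
  obtain ⟨C, hC⟩ := (Set.finite_range fun o => (n : ℝ) * (2 + ‖W o‖ / (86 * γ / 100))).bddAbove
  refine le_csSup ⟨C, ?_⟩ ⟨o, S, S', hS, hS', h, by rw [neg_sub_neg, abs_sub_comm]⟩
  rintro r ⟨o, S, S', hS, hS', -, rfl⟩
  rw [neg_sub_neg, abs_sub_comm]
  exact (abs_totalLoss_sub_le hγ _ hS hS').trans (hC ⟨o, rfl⟩)

/-- The example `(0, 1)` has loss `96 / 86` at every `w`. If replacing a data point by it never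
changes the total loss, then every data point already has that loss. -/
lemma totalLoss_eq_of_sensitivity_eq_zero [Finite O] {γ : ℝ} (hγ : 0 < γ) (W : O → E m)
    {T : Fin n → Example m} (hT : ∀ i, ‖(T i).1‖ ≤ 1)
    (h : sensitivity {z : Example m | ‖z.1‖ ≤ 1}
      (fun (T : Fin n → Example m) o => -totalLoss γ (W o) T) = 0) (o o' : O) :
    totalLoss γ (W o) T = totalLoss γ (W o') T := by
  suffices key : ∀ o, totalLoss γ (W o) T = n * (96 / 86) by rw [key, key]
  intro o
  have h1 : ∀ i, loss γ (W o) (T i) = 96 / 86 := by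
    intro i
    have hn : ∀ j, j ≠ i → T j = Function.update T i (0, 1) j := fun j hj => by
      rw [Function.update_of_ne hj]
    have h2 := le_sensitivity_totalLoss hγ W o hT (S' := Function.update T i (0, 1)) (fun j => by
      by_cases hj : j = i
      · subst hj
        simp
      · rw [Function.update_of_ne hj]
        exact hT j) ⟨i, hn⟩
    rw [h, totalLoss_sub_of_forall_ne (W o) hn, Function.update_self] at h2
    have h3 := sub_eq_zero.1 (abs_nonpos_iff.1 h2)
    rw [h3, loss, margin]
    simp [hγ]
  simp [totalLoss, h1]

/-- The supremum is over an uncountable family, but of functions continuous in `W`, so it is lower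
semicontinuous. -/
lemma measurable_sensitivity_totalLoss [Finite O] {γ : ℝ} (hγ : 0 < γ) :
    Measurable fun W : O → E m => sensitivity {z : Example m | ‖z.1‖ ≤ 1}
      (fun (T : Fin n → Example m) o => -totalLoss γ (W o) T) := by
  have hc : ∀ (o : O) (S : Fin n → Example m), Continuous fun W : O → E m => totalLoss γ (W o) S :=
    fun o S => continuous_finsetSum _ fun i _ =>
      (continuous_loss hγ (S i)).comp (continuous_apply o)
  let J := {q : O × (Fin n → Example m) × (Fin n → Example m) //
    (∀ i, q.2.1 i ∈ {z : Example m | ‖z.1‖ ≤ 1}) ∧ (∀ i, q.2.2 i ∈ {z : Example m | ‖z.1‖ ≤ 1}) ∧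
      Neighbors q.2.1 q.2.2}
  have heq : (fun W : O → E m => sensitivity {z : Example m | ‖z.1‖ ≤ 1}
      (fun (T : Fin n → Example m) o => -totalLoss γ (W o) T)) = fun W => ⨆ q : J,
        |-totalLoss γ (W q.1.1) q.1.2.1 - -totalLoss γ (W q.1.1) q.1.2.2| := by
    ext W
    rw [sensitivity, iSup]
    congr 1
    ext r
    constructor
    · rintro ⟨o, S, S', hS, hS', h, rfl⟩
      exact ⟨⟨(o, S, S'), hS, hS', h⟩, rfl⟩
    · rintro ⟨⟨⟨o, S, S'⟩, hS, hS', h⟩, rfl⟩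
      exact ⟨o, S, S', hS, hS', h, rfl⟩
  rw [heq]
  refine (lowerSemicontinuous_ciSup (fun W => ?_) fun q => ?_).measurable
  · obtain ⟨C, hC⟩ := (Set.finite_range fun o => (n : ℝ) * (2 + ‖W o‖ / (86 * γ / 100))).bddAbove
    refine ⟨C, ?_⟩
    rintro r ⟨⟨⟨o, S, S'⟩, hS, hS', h⟩, rfl⟩
    simp only [neg_sub_neg]
    rw [abs_sub_comm]
    exact (abs_totalLoss_sub_le hγ _ hS hS').trans (hC ⟨o, rfl⟩)
  · exact ((hc _ _).neg.sub (hc _ _).neg).abs.lowerSemicontinuous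

/-- The selection step of the private empirical risk minimizer. -/
lemma measurable_expMechanism_map {k : ℕ} {γ : ℝ} (hγ : 0 < γ) (ε : ℝ) :
    Measurable fun q : (Fin k → E m) × (Fin n → Example m) =>
      (expMechanism ε {z : Example m | ‖z.1‖ ≤ 1} (fun T' i => -totalLoss γ (q.1 i) T') q.2).map
        q.1 := by
  have hw : ∀ o, Measurable fun q : (Fin k → E m) × (Fin n → Example m) =>
      expWeight ε {z : Example m | ‖z.1‖ ≤ 1} (fun T' i => -totalLoss γ (q.1 i) T') q.2 o := by
    intro o
    unfold expWeight
    refine Real.measurable_exp.comp (((measurable_totalLoss γ ?_ ?_).neg.const_mul _).div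
      (((measurable_sensitivity_totalLoss hγ).comp measurable_fst).const_mul _)) <;> fun_prop
  refine Measure.measurable_of_measurable_coe _ fun s hs => ?_
  simp_rw [expMechanism_map_apply ε {z : Example m | ‖z.1‖ ≤ 1} _ _ (measurable_of_countable _) hs]
  refine Finset.measurable_sum _ fun o _ => Measurable.mul ?_ ?_
  · exact ((hw o).div (Finset.measurable_sum _ fun o _ => hw o)).ennreal_ofReal
  · exact (measurable_one.indicator hs).comp (by fun_prop)

lemma measurable_expMechanism_map_left {k : ℕ} {γ : ℝ} (hγ : 0 < γ) (ε : ℝ)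
    (T : Fin n → Example m) : Measurable fun W : Fin k → E m =>
      (expMechanism ε {z : Example m | ‖z.1‖ ≤ 1} (fun T' i => -totalLoss γ (W i) T') T).map W :=
  (measurable_expMechanism_map hγ ε).comp
    (by fun_prop : Measurable fun W : Fin k → E m => (W, T))

end LossSensitivity

/-! ### Utility of the private empirical risk minimizer -/

section PrivateERM

variable {m n : ℕ}

lemma one_le_numRuns {β : ℝ} (hβ : 0 < β) (hβ1 : β ≤ 1) : 1 ≤ numRuns β := by
  refine Nat.one_le_ceil_iff.2 (Real.log_pos ?_)
  rw [lt_div_iff₀ hβ]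
  linarith

/-- The guaranteed total loss of a single successful run of noisy gradient descent. -/
noncomputable def runBound (m n : ℕ) (γ ε δ : ℝ) : ℝ :=
  Real.exp 1 * (gradBound m n γ ε δ / n * (4 + 6 * Real.log n))

/-- Markov's inequality at `e` times the bound on the mean, so that `⌈log (8 / β)⌉` independent runs
all fail with probability at most `β / 8`. -/
lemma noiseGD_runBound_lt_le (hn : 1 ≤ n) {γ : ℝ} (hγ : 0 < γ) (hγ1 : γ ≤ 1) (ε δ : ℝ)
    {w₁ v₀ : E m} (hw₁ : ‖w₁‖ ≤ 1) (hv₀ : ‖v₀‖ ≤ 1) {T : Fin n → Example m}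
    (hT : ∀ i, ‖(T i).1‖ ≤ 1) (h0 : totalLoss γ v₀ T = 0) :
    noiseGD γ ε δ w₁ T {w | runBound m n γ ε δ < totalLoss γ w T}
      ≤ ENNReal.ofReal (Real.exp (-1)) := by
  have hn0 : (0 : ℝ) < n := by exact_mod_cast hn
  have hprob := isProbabilityMeasure_noiseGD hn γ ε δ w₁ T
  have hmeas : Measurable fun w => totalLoss γ w T :=
    measurable_totalLoss γ measurable_id measurable_const
  have hint : Integrable (fun w => totalLoss γ w T) (noiseGD γ ε δ w₁ T) :=
    BddMeas.integrable (B := {w : E m | ‖w‖ ≤ 1}) ⟨hmeas, n * (3 / γ), fun w hw => by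
      rw [abs_of_nonneg (totalLoss_nonneg hγ _ _)]
      exact totalLoss_le hγ hγ1 hw hT⟩ (ae_norm_le_noiseGD γ ε δ hw₁ T)
  have hI := integral_totalLoss_noiseGD_le hn hγ hγ1 ε δ hw₁ hv₀ hT h0
  set b := gradBound m n γ ε δ / n * (4 + 6 * Real.log n) with hb
  have hb0 : 0 < b := by
    have h1 := gradBound_pos (m := m) hn hγ ε δ
    have h2 : 0 ≤ Real.log n := Real.log_nonneg (by exact_mod_cast hn)
    positivity
  have hM := mul_meas_ge_le_integral_of_nonneg (μ := noiseGD γ ε δ w₁ T)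
    (Filter.Eventually.of_forall fun w => totalLoss_nonneg hγ w T) hint (Real.exp 1 * b)
  rw [← ofReal_measureReal]
  refine ENNReal.ofReal_le_ofReal ?_
  refine (measureReal_mono (s₂ := {w | Real.exp 1 * b ≤ totalLoss γ w T})
    (fun w hw => le_of_lt hw.out) (measure_ne_top _ _)).trans ?_
  rw [Real.exp_neg, ← one_div, le_div_iff₀ (Real.exp_pos 1)]
  have h3 : b * ((noiseGD γ ε δ w₁ T).real {w | Real.exp 1 * b ≤ totalLoss γ w T} * Real.exp 1)
      ≤ b * 1 := by linarith
  exact le_of_mul_le_mul_left h3 hb0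

lemma isProbabilityMeasure_privateERM (hn : 1 ≤ n) {β γ : ℝ} (hβ : 0 < β) (hβ1 : β ≤ 1)
    (hγ : 0 < γ) (ε δ : ℝ) (w₁ : E m) (T : Fin n → Example m) :
    IsProbabilityMeasure (privateERM β γ ε δ w₁ T) := by
  have : Nonempty (Fin (numRuns β)) := ⟨⟨0, one_le_numRuns hβ hβ1⟩⟩
  have := isProbabilityMeasure_noiseGD hn γ (ε / numRuns β) (δ / numRuns β) w₁ T
  refine isProbabilityMeasure_bind (measurable_expMechanism_map_left hγ ε T).aemeasurable
    (Filter.Eventually.of_forall fun W => ?_)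
  have := isProbabilityMeasure_expMechanism ε {z : Example m | ‖z.1‖ ≤ 1}
    (fun T' i => -totalLoss γ (W i) T') T
  exact Measure.isProbabilityMeasure_map (measurable_of_countable _).aemeasurable

/-- The private empirical risk minimizer finds a point of small total loss, if some point of
the ball has loss zero. -/
theorem privateERM_lt_totalLoss_le (hn : 1 ≤ n) {β γ ε : ℝ} (hβ : 0 < β) (hβ1 : β ≤ 1) (hγ : 0 < γ)
    (hγ1 : γ ≤ 1) (hε : 0 < ε) (δ : ℝ) {w₁ v₀ : E m} (hw₁ : ‖w₁‖ ≤ 1) (hv₀ : ‖v₀‖ ≤ 1)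
    {T : Fin n → Example m} (hT : ∀ i, ‖(T i).1‖ ≤ 1) (h0 : totalLoss γ v₀ T = 0) :
    privateERM β γ ε δ w₁ T {w | runBound m n γ (ε / numRuns β) (δ / numRuns β)
      + 2 * (3 / γ) * Real.log (numRuns β / (β / 8)) / ε < totalLoss γ w T}
      ≤ ENNReal.ofReal (β / 8) + ENNReal.ofReal (β / 8) := by
  have hk := one_le_numRuns hβ hβ1
  have hk1 : (1 : ℝ) ≤ numRuns β := by exact_mod_cast hk
  have := isProbabilityMeasure_noiseGD hn γ (ε / numRuns β) (δ / numRuns β) w₁ T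
  set μ := noiseGD γ (ε / numRuns β) (δ / numRuns β) w₁ T with hμ
  set b := runBound m n γ (ε / numRuns β) (δ / numRuns β) with hb
  have hTm : Measurable fun w => totalLoss γ w T :=
    measurable_totalLoss γ measurable_id measurable_const
  rw [privateERM, Measure.bind_apply (measurableSet_lt measurable_const hTm)
    (measurable_expMechanism_map_left hγ ε T).aemeasurable, ← hμ]
  have hrun : MeasurableSet {w | b < totalLoss γ w T} := measurableSet_lt measurable_const hTm
  -- The event that every run is bad. Off it some run has loss at most `b`, and the exponential
  -- mechanism competes with that run.
  let A : Set (Fin (numRuns β) → E m) := Set.univ.pi fun _ => {w | b < totalLoss γ w T}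
  have hA : MeasurableSet A := MeasurableSet.univ_pi fun _ => hrun
  have hball : ∀ᵐ W ∂(Measure.pi fun _ : Fin (numRuns β) => μ), ∀ i, ‖W i‖ ≤ 1 := by
    rw [ae_all_iff]
    intro i
    exact (measurePreserving_eval (fun _ : Fin (numRuns β) => μ) i).quasiMeasurePreserving.ae
      (ae_norm_le_noiseGD γ _ _ hw₁ T)
  calc _ ≤ ∫⁻ W, (A.indicator 1 W + ENNReal.ofReal (β / 8))
        ∂(Measure.pi fun _ : Fin (numRuns β) => μ) := by
        refine lintegral_mono_ae (hball.mono fun W hW => ?_)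
        by_cases hWA : W ∈ A
        · rw [Set.indicator_of_mem hWA, Pi.one_apply]
          have : Nonempty (Fin (numRuns β)) := ⟨⟨0, hk⟩⟩
          have := isProbabilityMeasure_expMechanism ε {z : Example m | ‖z.1‖ ≤ 1}
            (fun T' i => -totalLoss γ (W i) T') T
          have := Measure.isProbabilityMeasure_map
            (μ := expMechanism ε {z : Example m | ‖z.1‖ ≤ 1} (fun T' i => -totalLoss γ (W i) T') T)
            (measurable_of_countable W).aemeasurable
          exact prob_le_one.trans le_self_add
        · rw [Set.indicator_of_notMem hWA, zero_add]
          have hex : ∃ i, totalLoss γ (W i) T ≤ b := by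
            simpa [A] using hWA
          have := expMechanism_map_le hε {z : Example m | ‖z.1‖ ≤ 1}
            (fun T' i => -totalLoss γ (W i) T') T (measurable_of_countable W) hTm (fun o => rfl)
            (by positivity : 0 < β / 8) (sensitivity_totalLoss_le hγ hγ1 hW)
            (fun h o o' => totalLoss_eq_of_sensitivity_eq_zero hγ W hT h o o')
            (by rw [Fintype.card_fin]; linarith) hex
          rwa [Fintype.card_fin] at this
    _ = (Measure.pi fun _ : Fin (numRuns β) => μ) A + ENNReal.ofReal (β / 8) := by
        rw [lintegral_add_right _ measurable_const, lintegral_indicator_one hA, lintegral_const,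
          measure_univ, mul_one]
    _ ≤ _ := by
        gcongr
        rw [Measure.pi_pi, Finset.prod_const, Finset.card_univ, Fintype.card_fin]
        refine (pow_le_pow_left' (noiseGD_runBound_lt_le hn hγ hγ1 _ _ hw₁ hv₀ hT h0) _).trans ?_
        rw [← ENNReal.ofReal_pow (Real.exp_pos _).le, ← Real.exp_nat_mul]
        refine ENNReal.ofReal_le_ofReal ?_
        have h1 : Real.log (8 / β) ≤ numRuns β := Nat.le_ceil _
        have h2 : β / 8 = Real.exp (-Real.log (8 / β)) := by
          rw [Real.exp_neg, Real.exp_log (by positivity), inv_div]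
        rw [h2]
        exact Real.exp_le_exp.2 (by linarith)

end PrivateERM

/-! ### Measurable dependence of output laws on the data -/

section Kernels

variable {X Y Z Ω : Type*} [MeasurableSpace X] [MeasurableSpace Y] [MeasurableSpace Z]
  [MeasurableSpace Ω]

/-- A measurable family of probability measures is a Markov kernel, so the measure of the section at
`x` of a fixed measurable set depends measurably on `x`. -/
lemma measurable_map_of_isProbabilityMeasure {κ : X → Measure Y} (hκ : Measurable κ)
    (hp : ∀ x, IsProbabilityMeasure (κ x)) {F : X → Y → Z}
    (hF : Measurable fun p : X × Y => F p.1 p.2) : Measurable fun x => (κ x).map (F x) := by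
  refine Measure.measurable_of_measurable_coe _ fun s hs => ?_
  let K : Kernel X Y := ⟨κ, hκ⟩
  have : IsMarkovKernel K := ⟨hp⟩
  have h := Kernel.measurable_kernel_prodMk_left (κ := K) (hF hs)
  have heq : ∀ x, (κ x).map (F x) s = K x (Prod.mk x ⁻¹' ((fun p : X × Y => F p.1 p.2) ⁻¹' s)) := by
    intro x
    exact Measure.map_apply (hF.comp (measurable_const.prodMk measurable_id)) hs
  simp_rw [heq]
  exact h

lemma measurable_prod_const {κ : X → Measure Y} (hκ : Measurable κ)
    (hp : ∀ x, IsProbabilityMeasure (κ x)) (ν : Measure Ω) [IsProbabilityMeasure ν] :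
    Measurable fun x => (κ x).prod ν := by
  let K : Kernel X Y := ⟨κ, hκ⟩
  have : IsMarkovKernel K := ⟨hp⟩
  have h : (fun x => (κ x).prod ν) = fun x => (K ×ₖ Kernel.const X ν) x := by
    ext1 x
    rw [Kernel.prod_apply, Kernel.const_apply]
    rfl
  rw [h]
  exact (K ×ₖ Kernel.const X ν).measurable

/-- It suffices to test on the π-system of boxes, where the product measure is a finite product of
measurable functions. -/
lemma measurable_pi_const {k : ℕ} {κ : X → Measure Y} (hκ : Measurable κ)
    (hp : ∀ x, IsProbabilityMeasure (κ x)) :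
    Measurable fun x => Measure.pi fun _ : Fin k => κ x := by
  refine Measurable.measure_of_isPiSystem_of_isProbabilityMeasure generateFrom_pi.symm isPiSystem_pi
    ?_
  rintro _ ⟨t, ht, rfl⟩
  simp_rw [Measure.pi_pi]
  exact Finset.measurable_prod _ fun i _ => (Measure.measurable_coe (ht i trivial)).comp hκ

lemma measurable_bind_of_isProbabilityMeasure {κ : X → Measure Y} (hκ : Measurable κ)
    (hp : ∀ x, IsProbabilityMeasure (κ x)) {M : X → Y → Measure Z}
    (hM : Measurable fun p : X × Y => M p.1 p.2) : Measurable fun x => (κ x).bind (M x) := by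
  refine Measure.measurable_of_measurable_coe _ fun s hs => ?_
  let K : Kernel X Y := ⟨κ, hκ⟩
  have : IsMarkovKernel K := ⟨hp⟩
  have heq : ∀ x, (κ x).bind (M x) s = ∫⁻ y, M x y s ∂(K x) := fun x =>
    Measure.bind_apply hs (hM.comp (measurable_const.prodMk measurable_id)).aemeasurable
  simp_rw [heq]
  exact ((Measure.measurable_coe hs).comp hM).lintegral_kernel_prod_right'

end Kernels

section Algorithm

variable {m n : ℕ}

lemma measurable_noiseGD (hn : 1 ≤ n) (γ ε δ : ℝ) (w₁ : E m) :
    Measurable fun T : Fin n → Example m => noiseGD γ ε δ w₁ T := by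
  have hp := isProbabilityMeasure_stepNoise (m := m) hn
  unfold noiseGD
  generalize n ^ 2 - 1 = s
  induction s with
  | zero => exact measurable_const
  | succ s ih =>
    have hps : ∀ T : Fin n → Example m, IsProbabilityMeasure (noiseGDIterate γ ε δ w₁ T s) := by
      intro T
      rw [noiseGDIterate_eq_chain]
      exact isProbabilityMeasure_chain (fun t => measurable_noiseGDStep_prod γ ε δ T (t + 1)) _ _
    refine measurable_map_of_isProbabilityMeasure (measurable_prod_const ih hps (stepNoise m n))
      (fun T => inferInstance) ?_
    exact measurable_noiseGDStep γ ε δ (s + 1) (by fun_prop) (by fun_prop) (by fun_prop)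
      (by fun_prop)

lemma measurable_privateERM (hn : 1 ≤ n) (β : ℝ) {γ : ℝ} (hγ : 0 < γ) (ε δ : ℝ) (w₁ : E m) :
    Measurable fun T : Fin n → Example m => privateERM β γ ε δ w₁ T := by
  have hp := isProbabilityMeasure_noiseGD (m := m) hn γ (ε / numRuns β) (δ / numRuns β) w₁
  exact measurable_bind_of_isProbabilityMeasure
    (measurable_pi_const (measurable_noiseGD hn γ _ _ w₁) hp) (fun T => inferInstance)
    ((measurable_expMechanism_map hγ ε).comp measurable_swap)

@[fun_prop]
lemma continuous_matVec {d : ℕ} (A : Matrix (Fin m) (Fin d) ℝ) : Continuous (matVec A) := by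
  unfold matVec
  fun_prop

lemma measurable_projectData {d : ℕ} (A : Matrix (Fin m) (Fin d) ℝ) :
    Measurable fun S : Fin n → Example d => projectData A S := by
  unfold projectData
  have := (continuous_matVec A).measurable
  fun_prop

lemma norm_projectData_le {d : ℕ} (A : Matrix (Fin m) (Fin d) ℝ) (S : Fin n → Example d)
    (i : Fin n) : ‖(projectData A S i).1‖ ≤ 1 := by
  simp only [projectData, norm_smul, norm_inv, norm_norm]
  exact inv_mul_le_one

instance (m d : ℕ) : IsProbabilityMeasure (signLaw m d) := by
  have := isProbabilityMeasure_uniformOn (Set.finite_univ (α := ℤˣ)) Set.univ_nonempty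
  unfold signLaw
  infer_instance

variable {d : ℕ} (K α β γ ε δ : ℝ)

lemma measurable_halfspaceLearner_aux (hn : 1 ≤ n) {γ : ℝ} (hγ : 0 < γ)
    (w₁ : E m) : Measurable fun p : (Fin n → Example d) × (Fin m → Fin d → ℤˣ) =>
      (privateERM β γ ε δ w₁ (projectData (signMatrix p.2) p.1)).map
        (matVec (signMatrix p.2).transpose) := by
  refine measurable_from_prod_countable_left fun s => ?_
  exact (Measure.measurable_map (matVec (signMatrix s).transpose)
    (continuous_matVec _).measurable).comp ((measurable_privateERM hn β hγ ε δ w₁).comp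
      (measurable_projectData (signMatrix s)))

variable (d) in
lemma measurable_halfspaceLearner (hn : 1 ≤ n) {γ : ℝ} (hγ : 0 < γ)
    (w₁ : E (projDim K α β γ n)) :
    Measurable (halfspaceLearner (d := d) K α β γ ε δ n w₁) :=
  measurable_bind_of_isProbabilityMeasure measurable_const (fun _ => inferInstance)
    (measurable_halfspaceLearner_aux β ε δ hn hγ w₁)

lemma isProbabilityMeasure_halfspaceLearner (hn : 1 ≤ n) {β γ : ℝ} (hβ : 0 < β) (hβ1 : β ≤ 1)
    (hγ : 0 < γ) (w₁ : E (projDim K α β γ n)) (S : Fin n → Example d) :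
    IsProbabilityMeasure (halfspaceLearner K α β γ ε δ n w₁ S) := by
  refine isProbabilityMeasure_bind (measurable_of_countable _).aemeasurable
    (Filter.Eventually.of_forall fun s => ?_)
  have := isProbabilityMeasure_privateERM hn hβ hβ1 hγ ε δ w₁ (projectData (signMatrix s) S)
  exact Measure.isProbabilityMeasure_map (continuous_matVec _).measurable.aemeasurable

end Algorithm

/-! ### Generalization -/

/-- A finite `r`-net of the unit ball. -/
lemma exists_net_ball {m : ℕ} (hm : 1 ≤ m) {r : ℝ} (hr : 0 < r) (hr1 : r ≤ 1) :
    ∃ N : Finset (E m), (N.card : ℝ) ≤ (7 * m / r) ^ m ∧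
      ∀ w : E m, ‖w‖ ≤ 1 → ∃ v ∈ N, ‖w - v‖ ≤ r := by
  classical
  have hm0 : (1 : ℝ) ≤ m := by exact_mod_cast hm
  have hmr : 1 ≤ m / r := by rw [le_div_iff₀ hr]; linarith
  -- A cubic grid of spacing `r / m`. It is wasteful by a power of `m` per coordinate, but only the
  -- logarithm of its size matters.
  set M : ℕ := ⌈m / r⌉₊ + 1 with hM
  have hM1 : m / r + 1 ≤ M := by
    rw [hM]
    push_cast
    linarith [Nat.le_ceil (m / r)]
  have hM2 : (M : ℝ) ≤ m / r + 2 := by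
    rw [hM]
    push_cast
    linarith [(Nat.ceil_lt_add_one (by positivity : 0 ≤ m / r)).le]
  refine ⟨(Fintype.piFinset fun _ : Fin m => Finset.Icc (-(M : ℤ)) M).image
    fun j => WithLp.toLp 2 fun i => (j i : ℝ) * (r / m), ?_, fun w hw => ?_⟩
  · have h1 : ((Fintype.piFinset fun _ : Fin m => Finset.Icc (-(M : ℤ)) M).card : ℝ)
        = (2 * M + 1) ^ m := by
      rw [Fintype.card_piFinset]
      simp only [Int.card_Icc, Finset.prod_const, Finset.card_univ, Fintype.card_fin]
      rw [show ((M : ℤ) + 1 - -(M : ℤ)).toNat = 2 * M + 1 by omega]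
      push_cast
      rfl
    refine (Nat.cast_le.2 Finset.card_image_le).trans ?_
    rw [h1]
    refine pow_le_pow_left₀ (by positivity) ?_ m
    have : 7 * m / r = 7 * (m / r) := by ring
    rw [this]
    linarith
  · set j : Fin m → ℤ := fun i => round (w i * (m / r)) with hj
    have hjw : ∀ i, |w i * (m / r) - j i| ≤ 1 / 2 := fun i => abs_sub_round _
    have hwi : ∀ i, |w i * (m / r)| ≤ m / r := by
      intro i
      rw [abs_mul, abs_of_pos (by positivity : 0 < m / r)]
      refine mul_le_of_le_one_left (by positivity) ?_
      exact (PiLp.norm_apply_le w i).trans hw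
    refine ⟨_, Finset.mem_image_of_mem _ (a := j) (Fintype.mem_piFinset.2 fun i => ?_), ?_⟩
    · rw [Finset.mem_Icc]
      have h1 := abs_le.1 (hjw i)
      have h2 := abs_le.1 (hwi i)
      constructor
      · have : (-(M : ℝ)) ≤ j i := by linarith
        exact_mod_cast this
      · have : (j i : ℝ) ≤ M := by linarith
        exact_mod_cast this
    · have hcoord : ∀ i, ‖(w - WithLp.toLp 2 fun i => (j i : ℝ) * (r / m) : E m) i‖ ^ 2
          ≤ r ^ 2 / m := by
        intro i
        have h1 : (w - WithLp.toLp 2 fun i => (j i : ℝ) * (r / m) : E m) i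
            = (w i * (m / r) - j i) * (r / m) := by
          simp only [PiLp.sub_apply]
          field_simp
        rw [h1, norm_mul, mul_pow, Real.norm_eq_abs, Real.norm_eq_abs, sq_abs (r / m), div_pow]
        have h2 : |w i * (m / r) - j i| ^ 2 ≤ 1 := by
          have := hjw i
          have := abs_nonneg (w i * (m / r) - j i)
          nlinarith
        calc _ ≤ 1 * (r ^ 2 / (m : ℝ) ^ 2) := by gcongr
          _ ≤ _ := by
            rw [one_mul]
            refine div_le_div_of_nonneg_left (by positivity) (by positivity) ?_
            nlinarith
      have : ‖w - WithLp.toLp 2 fun i => (j i : ℝ) * (r / m)‖ ^ 2 ≤ r ^ 2 := by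
        rw [EuclideanSpace.norm_sq_eq]
        refine (Finset.sum_le_sum fun i _ => hcoord i).trans (le_of_eq ?_)
        rw [Finset.sum_const, Finset.card_univ, Fintype.card_fin, nsmul_eq_mul]
        field_simp
      exact (sq_le_sq₀ (norm_nonneg _) hr.le).1 this

/-- A Chernoff bound: an event of probability at least `a` rarely occurs in less than a fraction
`a / 50` of `n` independent trials. -/
lemma pi_sum_indicator_le {Z : Type*} [MeasurableSpace Z] (D : Measure Z) [IsProbabilityMeasure D]
    {A : Set Z} (hA : MeasurableSet A) {a : ℝ} (ha : 0 ≤ a) (hDA : a ≤ D.real A) (n : ℕ) :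
    (Measure.pi fun _ : Fin n => D)
      {S | ∑ i, A.indicator (1 : Z → ℝ) (S i) ≤ a * n / 50}
      ≤ ENNReal.ofReal (Real.exp (-(a * n / 2))) := by
  set q : ℝ := Real.exp (-1) with hq
  have hq0 : 0 < q := Real.exp_pos _
  -- This gives `E exp (-1_A) = 1 - (1 - q) P(A) ≤ exp (-0.6 a)`; Markov's inequality then leaves
  -- the exponent `0.6 - 1 / 50 ≥ 1 / 2`.
  have hq4 : q ≤ 0.4 := by
    have := Real.exp_neg_one_lt_d9
    rw [hq]
    linarith
  have hmI : Measurable (A.indicator (1 : Z → ℝ)) := measurable_one.indicator hA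
  have hI0 : ∀ z, 0 ≤ A.indicator (1 : Z → ℝ) z := fun z =>
    Set.indicator_nonneg (fun _ _ => zero_le_one) z
  have hf : ∀ z, Real.exp (-A.indicator (1 : Z → ℝ) z)
      = 1 - (1 - q) * A.indicator (1 : Z → ℝ) z := by
    intro z
    by_cases hz : z ∈ A <;> simp [hz, hq]
  have hint : ∫ z, Real.exp (-A.indicator (1 : Z → ℝ) z) ∂D ≤ Real.exp (-(0.6 * a)) := by
    simp_rw [hf]
    have hiI : Integrable (A.indicator (1 : Z → ℝ)) D := (integrable_const (1 : ℝ)).indicator hA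
    rw [integral_sub (integrable_const _) (hiI.const_mul _),
      integral_const_mul, integral_indicator_one hA]
    simp only [integral_const, probReal_univ, smul_eq_mul, one_mul]
    refine le_trans ?_ (Real.add_one_le_exp _)
    nlinarith
  have hprod : ∫ S : Fin n → Z, Real.exp (-∑ i, A.indicator (1 : Z → ℝ) (S i))
      ∂(Measure.pi fun _ : Fin n => D) ≤ Real.exp (-(0.6 * a * n)) := by
    simp_rw [← Finset.sum_neg_distrib, Real.exp_sum]
    rw [integral_fintype_prod_eq_pow (fun z => Real.exp (-A.indicator (1 : Z → ℝ) z)),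
      Fintype.card_fin]
    refine (pow_le_pow_left₀ (integral_nonneg fun z => (Real.exp_pos _).le) hint n).trans
      (le_of_eq ?_)
    rw [← Real.exp_nat_mul]
    congr 1
    ring
  have hmeas : Measurable fun S : Fin n → Z => Real.exp (-∑ i, A.indicator (1 : Z → ℝ) (S i)) := by
    fun_prop
  have hi : Integrable (fun S : Fin n → Z => Real.exp (-∑ i, A.indicator (1 : Z → ℝ) (S i)))
      (Measure.pi fun _ : Fin n => D) := by
    refine Integrable.of_bound hmeas.aestronglyMeasurable 1
      (Filter.Eventually.of_forall fun S => ?_)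
    rw [Real.norm_of_nonneg (Real.exp_pos _).le, Real.exp_le_one_iff]
    linarith [Finset.sum_nonneg fun i (_ : i ∈ Finset.univ) => hI0 (S i)]
  have hM := mul_meas_ge_le_integral_of_nonneg
    (Filter.Eventually.of_forall fun S => (Real.exp_pos _).le) hi (Real.exp (-(a * n / 50)))
  rw [← ofReal_measureReal]
  refine ENNReal.ofReal_le_ofReal ?_
  have hsub : {S : Fin n → Z | ∑ i, A.indicator (1 : Z → ℝ) (S i) ≤ a * n / 50}
      = {S | Real.exp (-(a * n / 50)) ≤ Real.exp (-∑ i, A.indicator (1 : Z → ℝ) (S i))} := by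
    ext S
    simp only [Set.mem_ofPred_eq, Real.exp_le_exp, neg_le_neg_iff]
  rw [hsub]
  have h1 := hM.trans hprod
  rw [← le_div_iff₀' (Real.exp_pos _), ← Real.exp_sub] at h1
  refine h1.trans (Real.exp_le_exp.2 ?_)
  have : 0 ≤ a * n := by positivity
  linarith

/-- Uniform convergence over the unit ball: outside an event of small probability, each `w` of small
total loss has a small probability of error. -/
theorem exists_measurableSet_error_le {Z : Type*} [MeasurableSpace Z] (D : Measure Z)
    [IsProbabilityMeasure D] {m n : ℕ} (hm : 1 ≤ m) {γ α : ℝ} (hγ : 0 < γ) (hγ1 : γ ≤ 1)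
    (hα : 0 ≤ α) {φ : Z → Example m} (hφ : Measurable φ) (hφ1 : ∀ z, ‖(φ z).1‖ ≤ 1) :
    ∃ G : Set (Fin n → Z), MeasurableSet G ∧
      (Measure.pi fun _ : Fin n => D) G
        ≤ ENNReal.ofReal ((35 * m / γ) ^ m * Real.exp (-(α * n / 2))) ∧
      ∀ S ∉ G, ∀ w : E m, ‖w‖ ≤ 1 → totalLoss γ w (fun i => φ (S i)) ≤ α * n / 100 →
        D.real {z | margin w (φ z) ≤ 0} ≤ α := by
  classical
  obtain ⟨N, hN, hNw⟩ := exists_net_ball hm (by positivity : 0 < γ / 5) (by linarith)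
  let A : E m → Set Z := fun v => {z | margin v (φ z) ≤ γ / 5}
  have hA : ∀ v, MeasurableSet (A v) := fun v =>
    measurableSet_le (measurable_margin measurable_const hφ) measurable_const
  -- Only net points with a large probability of small margin can be misleading; the exceptional
  -- event is that the sample under-represents this for one of them.
  let N' := N.filter fun v => α < D.real (A v)
  refine ⟨⋃ v ∈ N', {S | ∑ i, (A v).indicator (1 : Z → ℝ) (S i) ≤ α * n / 50},
    Finset.measurableSet_biUnion _ fun v _ => ?_, ?_, fun S hS w hw hloss => ?_⟩
  · have := measurable_one (α := ℝ).indicator (hA v)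
    exact measurableSet_le (Finset.measurable_sum _ fun i _ => this.comp (measurable_pi_apply i))
      measurable_const
  · refine (measure_biUnion_finset_le _ _).trans ((Finset.sum_le_sum fun v hv =>
      pi_sum_indicator_le D (hA v) hα (Finset.mem_filter.1 hv).2.le n).trans ?_)
    rw [Finset.sum_const, nsmul_eq_mul, ← ENNReal.ofReal_natCast,
      ← ENNReal.ofReal_mul (by positivity)]
    refine ENNReal.ofReal_le_ofReal (mul_le_mul_of_nonneg_right ?_ (Real.exp_pos _).le)
    refine (Nat.cast_le.2 (Finset.card_filter_le _ _)).trans (hN.trans (le_of_eq ?_))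
    congr 1
    field_simp
    norm_num
  · by_contra! hlt
    obtain ⟨v, hvN, hv⟩ := hNw w hw
    have hclose : ∀ z, |margin w (φ z) - margin v (φ z)| ≤ γ / 5 := by
      intro z
      rw [← margin_sub]
      refine (abs_margin_le _ _).trans ?_
      have := hφ1 z
      nlinarith [norm_nonneg (w - v), norm_nonneg (φ z).1]
    have hsub : {z | margin w (φ z) ≤ 0} ⊆ A v := by
      intro z hz
      have := abs_le.1 (hclose z)
      have hz' : margin w (φ z) ≤ 0 := hz
      change margin v (φ z) ≤ γ / 5
      linarith
    have hvN' : v ∈ N' := Finset.mem_filter.2 ⟨hvN, hlt.trans_le (measureReal_mono hsub)⟩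
    have hcount : α * n / 50 < ∑ i, (A v).indicator (1 : Z → ℝ) (S i) := by
      by_contra! hle
      exact hS (Set.mem_biUnion hvN' hle)
    have hle : ∑ i, (A v).indicator (1 : Z → ℝ) (S i) ≤ 2 * totalLoss γ w (fun i => φ (S i)) := by
      rw [totalLoss, Finset.mul_sum]
      refine Finset.sum_le_sum fun i _ => ?_
      by_cases hz : S i ∈ A v
      · rw [Set.indicator_of_mem hz, Pi.one_apply]
        have h1 := abs_le.1 (hclose (S i))
        have h2 : margin v (φ (S i)) ≤ γ / 5 := hz
        have := half_le_loss hγ (w := w) (z := φ (S i)) (by linarith)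
        linarith
      · rw [Set.indicator_of_notMem hz]
        linarith [loss_nonneg hγ w (φ (S i))]
    linarith

/-! ### Random signs -/

section Signs

instance : IsProbabilityMeasure (uniformOn (Set.univ : Set ℤˣ)) :=
  isProbabilityMeasure_uniformOn Set.finite_univ Set.univ_nonempty

lemma integral_sign (f : ℤˣ → ℝ) :
    ∫ u, f u ∂(uniformOn (Set.univ : Set ℤˣ)) = (f 1 + f (-1)) / 2 := by
  rw [integral_uniformOn_univ, Fintype.card_units_int,
    show (Finset.univ : Finset ℤˣ) = {1, -1} from rfl,
    Finset.sum_pair (by decide)]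
  norm_num

/-- The law of a row of signs. -/
noncomputable abbrev rowLaw (d : ℕ) : Measure (Fin d → ℤˣ) :=
  Measure.pi fun _ => uniformOn (Set.univ : Set ℤˣ)

/-- The signed sum `∑ j, s j * u j`. -/
def signSum {d : ℕ} (u : E d) (s : Fin d → ℤˣ) : ℝ := ∑ j, ((s j : ℤ) : ℝ) * u j

variable {d : ℕ} {u : E d}

/-- The signs are independent, so the expectation factors, and each factor is `cosh (t u_j) ≤ exp
((t u_j) ^ 2 / 2)`. -/
lemma integral_exp_mul_signSum_le (hu : ‖u‖ = 1) (t : ℝ) :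
    ∫ s, Real.exp (t * signSum u s) ∂(rowLaw d) ≤ Real.exp (t ^ 2 / 2) := by
  have h1 : ∀ s, Real.exp (t * signSum u s) = ∏ j, Real.exp (((s j : ℤ) : ℝ) * (t * u j)) := by
    intro s
    rw [← Real.exp_sum, signSum, Finset.mul_sum]
    congr 1
    exact Finset.sum_congr rfl fun j _ => by ring
  simp_rw [h1]
  rw [integral_fintype_prod_eq_prod fun j (x : ℤˣ) => Real.exp (((x : ℤ) : ℝ) * (t * u j))]
  have h2 : t ^ 2 / 2 = ∑ j, (t * u j) ^ 2 / 2 := by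
    have : ∑ j, u j ^ 2 = 1 := by
      rw [← EuclideanSpace.real_norm_sq_eq, hu, one_pow]
    rw [← Finset.sum_div]
    simp_rw [mul_pow]
    rw [← Finset.mul_sum, this, mul_one]
  rw [h2, Real.exp_sum]
  refine Finset.prod_le_prod (fun j _ => integral_nonneg fun x => (Real.exp_pos _).le) fun j _ => ?_
  rw [integral_sign]
  refine le_trans (le_of_eq ?_) (Real.cosh_le_exp_half_sq _)
  rw [Real.cosh_eq]
  simp

lemma gaussianPDFReal_mul_exp_sq_div_two (t : ℝ) :
    gaussianPDFReal 0 (1 / 2) t * Real.exp (t ^ 2 / 2)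
      = (√Real.pi)⁻¹ * Real.exp (-(1 / 2) * t ^ 2) := by
  have h : 2 * Real.pi * ((1 / 2 : NNReal) : ℝ) = Real.pi := by
    push_cast
    ring
  rw [gaussianPDFReal, mul_assoc, ← Real.exp_add, h]
  push_cast
  congr 2
  ring

lemma integral_exp_sq_div_two_gaussianReal :
    ∫ t, Real.exp (t ^ 2 / 2) ∂(gaussianReal 0 (1 / 2)) ≤ 2 := by
  rw [integral_gaussianReal_eq_integral_smul (by norm_num)]
  simp_rw [smul_eq_mul, gaussianPDFReal_mul_exp_sq_div_two]
  rw [integral_const_mul, integral_gaussian, div_div_eq_mul_div, div_one,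
    Real.sqrt_mul Real.pi_pos.le, ← mul_assoc,
    inv_mul_cancel₀ (Real.sqrt_pos.2 Real.pi_pos).ne', one_mul, Real.sqrt_le_iff]
  norm_num

/-- Linearize the square: `exp (x ^ 2 / 4)` is the mean of `exp (x g)` for a Gaussian `g` of
variance `1 / 2`. Exchanging the expectations and using the sub-Gaussian bound leaves the mean of
`exp (g ^ 2 / 2)`, which is `√2`. -/
lemma integral_exp_sq_signSum_le (hu : ‖u‖ = 1) :
    ∫ s, Real.exp (signSum u s ^ 2 / 4) ∂(rowLaw d) ≤ 2 := by
  have h1 : ∀ s, Real.exp (signSum u s ^ 2 / 4)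
      = ∫ t, Real.exp (signSum u s * t) ∂(gaussianReal 0 (1 / 2)) := by
    intro s
    have := mgf_gaussianReal (p := gaussianReal 0 (1 / 2)) (X := id) Measure.map_id (signSum u s)
    rw [mgf] at this
    simp only [id_eq] at this
    rw [this]
    congr 1
    push_cast
    ring
  have hI := fun s => integrable_exp_mul_gaussianReal (μ := 0) (v := 1 / 2) (signSum u s)
  simp_rw [h1]
  rw [integral_fintype Integrable.of_finite]
  simp_rw [smul_eq_mul, ← integral_const_mul]
  rw [← integral_finsetSum _ fun s _ => (hI s).const_mul _]
  refine le_trans (integral_mono_of_nonneg (Filter.Eventually.of_forall fun t => ?_) ?_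
    (Filter.Eventually.of_forall fun t => ?_)) integral_exp_sq_div_two_gaussianReal
  · exact Finset.sum_nonneg fun s _ => mul_nonneg measureReal_nonneg (Real.exp_pos _).le
  · rw [gaussianReal_of_var_ne_zero _ (by norm_num), integrable_withDensity_iff_integrable_smul₀'
      (measurable_gaussianPDF _ _).aemeasurable
      (Filter.Eventually.of_forall fun _ => ENNReal.ofReal_lt_top)]
    simp_rw [toReal_gaussianPDF, smul_eq_mul, gaussianPDFReal_mul_exp_sq_div_two]
    exact (integrable_exp_neg_mul_sq (by norm_num)).const_mul _
  · have := integral_exp_mul_signSum_le hu t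
    rw [integral_fintype Integrable.of_finite] at this
    simp_rw [mul_comm _ t]
    exact this

lemma integral_signSum_sq (hu : ‖u‖ = 1) : ∫ s, signSum u s ^ 2 ∂(rowLaw d) = 1 := by
  have h0 : ∫ s, signSum u s ∂(rowLaw d) = 0 := by
    unfold signSum
    rw [integral_finsetSum _ fun _ _ => Integrable.of_finite]
    refine Finset.sum_eq_zero fun j _ => ?_
    have h1 := integral_comp_eval (μ := fun _ : Fin d => uniformOn (Set.univ : Set ℤˣ)) (i := j)
      (f := fun x : ℤˣ => ((x : ℤ) : ℝ) * u j) (measurable_of_countable _).aestronglyMeasurable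
    rw [h1, integral_sign]
    simp
  have hv := variance_sum_pi (μ := fun _ : Fin d => uniformOn (Set.univ : Set ℤˣ))
    (X := fun j (x : ℤˣ) => ((x : ℤ) : ℝ) * u j) fun j => MemLp.of_discrete
  have hs : (∑ j, fun s : Fin d → ℤˣ => ((s j : ℤ) : ℝ) * u j) = signSum u := by
    ext s
    simp [signSum]
  rw [hs, variance_of_integral_eq_zero (measurable_of_countable _).aemeasurable h0] at hv
  rw [hv, ← one_pow 2, ← hu, EuclideanSpace.real_norm_sq_eq]
  refine Finset.sum_congr rfl fun j _ => ?_
  rw [variance_of_integral_eq_zero (measurable_of_countable _).aemeasurable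
    (by rw [integral_sign]; simp)]
  rw [integral_sign]
  simp

lemma exp_le_one_add_add_sq_mul (x : ℝ) : Real.exp x ≤ 1 + x + x ^ 2 * Real.exp |x| := by
  have h := Complex.norm_exp_sub_sum_le_norm_mul_exp (x : ℂ) 2
  have h1 : Complex.exp x - ∑ m ∈ Finset.range 2, (x : ℂ) ^ m / (m.factorial : ℂ)
      = ((Real.exp x - (1 + x) : ℝ) : ℂ) := by
    simp [Finset.sum_range_succ]
  rw [h1, Complex.norm_real, Complex.norm_real, Real.norm_eq_abs, Real.norm_eq_abs, sq_abs] at h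
  linarith [le_abs_self (Real.exp x - (1 + x))]

/-- Expand to second order. The linear term vanishes because the square has mean `1`, and the
remainder is controlled by `exp (q / 4)`, of mean at most `2`; thus `340 = 2 * 170`, where `170 ≥
128 * 1.3`. -/
lemma integral_exp_mul_sq_sub_one_le (hu : ‖u‖ = 1) {h : ℝ} (hh : |h| ≤ 1 / 8) :
    ∫ s, Real.exp (h * (signSum u s ^ 2 - 1)) ∂(rowLaw d) ≤ Real.exp (340 * h ^ 2) := by
  have hpt : ∀ s, Real.exp (h * (signSum u s ^ 2 - 1)) ≤ 1 + h * (signSum u s ^ 2 - 1)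
      + 170 * h ^ 2 * Real.exp (signSum u s ^ 2 / 4) := by
    intro s
    set q := signSum u s ^ 2 with hq
    have hq0 : 0 ≤ q := sq_nonneg _
    refine (exp_le_one_add_add_sq_mul _).trans ?_
    have hy : |q - 1| ≤ q + 1 := abs_le.2 ⟨by linarith, by linarith⟩
    have h1 : Real.exp |h * (q - 1)| ≤ Real.exp (|q - 1| / 8) := by
      rw [abs_mul]
      exact Real.exp_le_exp.2 (by nlinarith [abs_nonneg (q - 1)])
    have h2 : (q - 1) ^ 2 ≤ 128 * Real.exp (|q - 1| / 8) := by
      have := Real.quadratic_le_exp_of_nonneg (by positivity : 0 ≤ |q - 1| / 8)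
      have h3 : (|q - 1| / 8) ^ 2 = (q - 1) ^ 2 / 64 := by
        rw [div_pow, sq_abs]
        norm_num
      rw [h3] at this
      have := abs_nonneg (q - 1)
      linarith
    have h3 : Real.exp (|q - 1| / 8) * Real.exp (|q - 1| / 8) ≤ 1.3 * Real.exp (q / 4) := by
      rw [← Real.exp_add]
      have h4 : Real.exp (1 / 4) ≤ 1.3 := by
        have h5 : Real.exp (1 / 4) ^ 4 = Real.exp 1 := by
          rw [← Real.exp_nat_mul]
          norm_num
        have h6 := Real.exp_one_lt_d9
        by_contra! hlt
        have : (1.3 : ℝ) ^ 4 < Real.exp (1 / 4) ^ 4 := by gcongr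
        rw [h5] at this
        norm_num at this
        linarith
      calc _ ≤ Real.exp (1 / 4 + q / 4) := Real.exp_le_exp.2 (by linarith)
        _ = Real.exp (1 / 4) * Real.exp (q / 4) := Real.exp_add _ _
        _ ≤ _ := by gcongr
    have h4 : (h * (q - 1)) ^ 2 * Real.exp |h * (q - 1)| ≤ 170 * h ^ 2 * Real.exp (q / 4) := by
      calc (h * (q - 1)) ^ 2 * Real.exp |h * (q - 1)|
          ≤ (h ^ 2 * (128 * Real.exp (|q - 1| / 8))) * Real.exp (|q - 1| / 8) := by
            rw [mul_pow]
            gcongr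
        _ = h ^ 2 * 128 * (Real.exp (|q - 1| / 8) * Real.exp (|q - 1| / 8)) := by ring
        _ ≤ h ^ 2 * 128 * (1.3 * Real.exp (q / 4)) := by gcongr
        _ ≤ _ := by
          have : 0 ≤ h ^ 2 * Real.exp (q / 4) := by positivity
          nlinarith
    linarith
  calc _ ≤ ∫ s, (1 + h * (signSum u s ^ 2 - 1) + 170 * h ^ 2 * Real.exp (signSum u s ^ 2 / 4))
        ∂(rowLaw d) := integral_mono Integrable.of_finite Integrable.of_finite hpt
    _ = 1 + 170 * h ^ 2 * ∫ s, Real.exp (signSum u s ^ 2 / 4) ∂(rowLaw d) := by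
        rw [integral_add Integrable.of_finite Integrable.of_finite,
          integral_add Integrable.of_finite Integrable.of_finite, integral_const_mul,
          integral_const_mul, integral_sub Integrable.of_finite Integrable.of_finite,
          integral_signSum_sq hu]
        simp
    _ ≤ 1 + 170 * h ^ 2 * 2 := by
        gcongr
        exact integral_exp_sq_signSum_le hu
    _ ≤ _ := by
        linarith [Real.add_one_le_exp (340 * h ^ 2)]

end Signs

/-! ### The Johnson–Lindenstrauss lemma -/

section JohnsonLindenstrauss

variable {m d : ℕ}

lemma norm_matVec_signMatrix_sq (u : E d) (s : Fin m → Fin d → ℤˣ) :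
    ‖matVec (signMatrix s) u‖ ^ 2 = (∑ i, signSum u (s i) ^ 2) / m := by
  rw [EuclideanSpace.real_norm_sq_eq, Finset.sum_div]
  refine Finset.sum_congr rfl fun i _ => ?_
  have : (matVec (signMatrix s) u) i = signSum u (s i) / √m := by
    simp only [matVec, signMatrix, Matrix.mulVec, dotProduct, Matrix.of_apply, signSum,
      Finset.sum_div]
    exact Finset.sum_congr rfl fun j _ => by ring
  rw [this, div_pow, Real.sq_sqrt (by positivity)]

lemma signLaw_chernoff {u : E d} (hu : ‖u‖ = 1) {h τ : ℝ} (hh : |h| ≤ 1 / 8) :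
    (signLaw m d).real {s | τ * m ≤ ∑ i, h * (signSum u (s i) ^ 2 - 1)}
      ≤ Real.exp (340 * h ^ 2 * m - τ * m) := by
  have hM := mul_meas_ge_le_integral_of_nonneg (μ := signLaw m d)
    (f := fun s => Real.exp (∑ i, h * (signSum u (s i) ^ 2 - 1)))
    (Filter.Eventually.of_forall fun s => (Real.exp_pos _).le) Integrable.of_finite
    (Real.exp (τ * m))
  have hI : ∫ s, Real.exp (∑ i, h * (signSum u (s i) ^ 2 - 1)) ∂(signLaw m d)
      ≤ Real.exp (340 * h ^ 2 * m) := by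
    simp_rw [Real.exp_sum]
    rw [signLaw, integral_fintype_prod_eq_pow (fun s : Fin d → ℤˣ =>
      Real.exp (h * (signSum u s ^ 2 - 1))), Fintype.card_fin]
    refine (pow_le_pow_left₀ (integral_nonneg fun s => (Real.exp_pos _).le)
      (integral_exp_mul_sq_sub_one_le hu hh) m).trans (le_of_eq ?_)
    rw [← Real.exp_nat_mul, mul_comm]
  simp only [Real.exp_le_exp] at hM
  have h1 := hM.trans hI
  rwa [← le_div_iff₀' (Real.exp_pos _), ← Real.exp_sub] at h1

lemma signLaw_norm_sq_of_norm_eq_one {u : E d} (hu : ‖u‖ = 1) (hm : 1 ≤ m) {τ : ℝ} (hτ : 0 < τ)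
    (hτ1 : τ ≤ 1) :
    (signLaw m d).real {s | τ < |‖matVec (signMatrix s) u‖ ^ 2 - 1|}
      ≤ 2 * Real.exp (-(τ ^ 2 * m / 1360)) := by
  have hm0 : (0 : ℝ) < m := by exact_mod_cast hm
  -- The choice `h = ± τ / 680` minimizes `340 h ^ 2 - |h| τ`, with value `-τ ^ 2 / 1360`.
  have hh : |τ / 680| ≤ 1 / 8 := by
    rw [abs_of_pos (by positivity)]
    linarith
  have h1 := signLaw_chernoff (m := m) hu (τ := τ ^ 2 / 680) hh
  have h2 := signLaw_chernoff (m := m) hu (τ := τ ^ 2 / 680) (h := -(τ / 680)) (by rwa [abs_neg])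
  have hsub : {s : Fin m → Fin d → ℤˣ | τ < |‖matVec (signMatrix s) u‖ ^ 2 - 1|} ⊆
      {s | τ ^ 2 / 680 * m ≤ ∑ i, τ / 680 * (signSum u (s i) ^ 2 - 1)} ∪
      {s | τ ^ 2 / 680 * m ≤ ∑ i, -(τ / 680) * (signSum u (s i) ^ 2 - 1)} := by
    intro s hs
    have hs' : τ < |‖matVec (signMatrix s) u‖ ^ 2 - 1| := hs
    have h3 : ∑ i, (signSum u (s i) ^ 2 - 1) = m * (‖matVec (signMatrix s) u‖ ^ 2 - 1) := by
      rw [norm_matVec_signMatrix_sq, Finset.sum_sub_distrib]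
      simp
      field_simp
    simp only [Set.mem_union, Set.mem_ofPred_eq, ← Finset.mul_sum, h3]
    have h4 : 0 ≤ τ / 680 * m := by positivity
    rcases lt_abs.1 hs' with h | h
    · left
      nlinarith
    · right
      nlinarith
  refine (measureReal_mono hsub).trans ((measureReal_union_le _ _).trans ?_)
  have h3 : 340 * (τ / 680) ^ 2 * m - τ ^ 2 / 680 * m = -(τ ^ 2 * m / 1360) := by ring
  rw [neg_sq, h3] at h2
  rw [h3] at h1
  linarith

lemma matVec_smul (A : Matrix (Fin m) (Fin d) ℝ) (c : ℝ) (u : E d) :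
    matVec A (c • u) = c • matVec A u := by
  simp [matVec, Matrix.mulVec_smul]

lemma matVec_add (A : Matrix (Fin m) (Fin d) ℝ) (u v : E d) :
    matVec A (u + v) = matVec A u + matVec A v := by
  simp [matVec, Matrix.mulVec_add]

lemma matVec_sub (A : Matrix (Fin m) (Fin d) ℝ) (u v : E d) :
    matVec A (u - v) = matVec A u - matVec A v := by
  simp [matVec, Matrix.mulVec_sub]

/-- `A` distorts the squared norm of `u` by a factor of more than `1 ± τ`. -/
def Distorts (A : Matrix (Fin m) (Fin d) ℝ) (τ : ℝ) (u : E d) : Prop :=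
  τ * ‖u‖ ^ 2 < |‖matVec A u‖ ^ 2 - ‖u‖ ^ 2|

/-- The Johnson–Lindenstrauss lemma for random sign matrices. -/
theorem signLaw_distorts_le (u : E d) (hm : 1 ≤ m) {τ : ℝ} (hτ : 0 < τ) (hτ1 : τ ≤ 1) :
    signLaw m d {s | Distorts (signMatrix s) τ u}
      ≤ ENNReal.ofReal (2 * Real.exp (-(τ ^ 2 * m / 1360))) := by
  rw [← ofReal_measureReal]
  refine ENNReal.ofReal_le_ofReal ?_
  by_cases hu : u = 0
  · have : {s : Fin m → Fin d → ℤˣ | Distorts (signMatrix s) τ u} = ∅ := by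
      ext s
      have h0 : matVec (signMatrix s) (0 : E d) = 0 := by simp [matVec]
      simp [Distorts, hu, h0]
    rw [this, measureReal_empty]
    positivity
  · have hpos : 0 < ‖u‖ := norm_pos_iff.2 hu
    have hv : ‖‖u‖⁻¹ • u‖ = 1 := norm_smul_inv_norm hu
    refine (measureReal_mono fun s hs => ?_).trans (signLaw_norm_sq_of_norm_eq_one hv hm hτ hτ1)
    have hs' : τ * ‖u‖ ^ 2 < |‖matVec (signMatrix s) u‖ ^ 2 - ‖u‖ ^ 2| := hs
    change τ < _
    rw [matVec_smul, norm_smul, norm_inv, norm_norm, mul_pow]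
    have h1 : ‖u‖⁻¹ ^ 2 * ‖matVec (signMatrix s) u‖ ^ 2 - 1
        = ‖u‖⁻¹ ^ 2 * (‖matVec (signMatrix s) u‖ ^ 2 - ‖u‖ ^ 2) := by
      field_simp
    rw [h1, abs_mul, abs_of_nonneg (by positivity : 0 ≤ ‖u‖⁻¹ ^ 2), inv_pow, ← div_eq_inv_mul,
      lt_div_iff₀ (by positivity)]
    exact hs'

/-- Polarization: `4 ⟨w, x⟩ = ‖w + x‖ ^ 2 - ‖w - x‖ ^ 2`, and the two errors sum to at most `2 τ
(‖w‖ ^ 2 + ‖x‖ ^ 2) ≤ 4 τ`. -/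
lemma abs_inner_matVec_sub_le {A : Matrix (Fin m) (Fin d) ℝ} {τ : ℝ} (hτ : 0 ≤ τ) {w x : E d}
    (hw : ‖w‖ ≤ 1) (hx : ‖x‖ ≤ 1) (h1 : ¬ Distorts A τ (w + x)) (h2 : ¬ Distorts A τ (w - x)) :
    |inner ℝ (matVec A w) (matVec A x) - inner ℝ w x| ≤ τ := by
  have h1' := abs_le.1 (not_lt.1 h1)
  have h2' := abs_le.1 (not_lt.1 h2)
  rw [matVec_add] at h1'
  rw [matVec_sub] at h2'
  rw [norm_add_sq_real, norm_add_sq_real] at h1'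
  rw [norm_sub_sq_real, norm_sub_sq_real] at h2'
  have h3 : ‖w‖ ^ 2 ≤ 1 := by nlinarith [norm_nonneg w]
  have h4 : ‖x‖ ^ 2 ≤ 1 := by nlinarith [norm_nonneg x]
  have h5 : τ * ‖w‖ ^ 2 ≤ τ := mul_le_of_le_one_right hτ h3
  have h6 : τ * ‖x‖ ^ 2 ≤ τ := mul_le_of_le_one_right hτ h4
  rw [abs_le]
  constructor <;> nlinarith

lemma norm_matVec_le {A : Matrix (Fin m) (Fin d) ℝ} {τ : ℝ} (hτ : 0 ≤ τ) (hτ1 : τ ≤ 1 / 100)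
    {w : E d} (hw : ‖w‖ ≤ 1) (h : ¬ Distorts A τ w) : ‖matVec A w‖ ≤ 1.01 := by
  have h1 := abs_le.1 (not_lt.1 h)
  have h3 : ‖w‖ ^ 2 ≤ 1 := by nlinarith [norm_nonneg w]
  have h5 : τ * ‖w‖ ^ 2 ≤ τ := mul_le_of_le_one_right hτ h3
  nlinarith [norm_nonneg (matVec A w)]

/-- If `A` nearly preserves the relevant norms, then it nearly preserves the margin. -/
lemma le_margin_projBall_matVec {A : Matrix (Fin m) (Fin d) ℝ} {γ : ℝ} (hγ : 0 < γ) (hγ1 : γ ≤ 1)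
    {w : E d} {z : Example d} (hw : ‖w‖ ≤ 1) (hz : ‖z.1‖ ≤ 1) (hm : γ ≤ margin w z)
    (h1 : ¬ Distorts A (γ / 100) w) (h2 : ¬ Distorts A (γ / 100) z.1)
    (h3 : ¬ Distorts A (γ / 100) (w + z.1)) (h4 : ¬ Distorts A (γ / 100) (w - z.1)) :
    96 * γ / 100 ≤ margin (projBall (matVec A w)) (‖matVec A z.1‖⁻¹ • matVec A z.1, z.2) := by
  have hτ : 0 ≤ γ / 100 := by positivity
  have hτ1 : γ / 100 ≤ 1 / 100 := by linarith
  have hW := norm_matVec_le hτ hτ1 hw h1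
  have hX := norm_matVec_le hτ hτ1 hz h2
  have hI := abs_inner_matVec_sub_le hτ hw hz h3 h4
  set a := matVec A w
  set b := matVec A z.1
  have hip : 99 / 100 * γ ≤ label z * inner ℝ a b := by
    have e : label z * inner ℝ a b = margin w z + label z * (inner ℝ a b - inner ℝ w z.1) := by
      rw [margin]
      ring
    have e2 : |label z * (inner ℝ a b - inner ℝ w z.1)| ≤ γ / 100 := by
      rwa [abs_mul, abs_label, one_mul]
    rw [e]
    linarith [(abs_le.1 e2).1]
  -- The positive inner product rules out `A x = 0`, so the normalization of the point is genuine.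
  have hb : 0 < ‖b‖ := by
    refine norm_pos_iff.2 fun h => ?_
    rw [h, inner_zero_right, mul_zero] at hip
    linarith
  have hmax : 0 < max 1 ‖a‖ := lt_max_of_lt_left one_pos
  have hmax' : max 1 ‖a‖ ≤ 1.01 := max_le (by norm_num) hW
  have heq : margin (projBall a) (‖b‖⁻¹ • b, z.2) = label z * inner ℝ a b / (max 1 ‖a‖ * ‖b‖) := by
    simp only [margin, projBall, real_inner_smul_left, real_inner_smul_right, label]
    field_simp
  rw [heq, le_div_iff₀ (by positivity)]
  -- The slack that fixes the threshold of the loss: `0.99 / 1.01 ^ 2 > 0.96`.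
  have h5 : max 1 ‖a‖ * ‖b‖ ≤ 1.01 * 1.01 := by gcongr
  nlinarith

end JohnsonLindenstrauss

/-! ### The choice of the sample size -/

section SampleSize

/-- `A (Λ + log n)⁴ ≤ p n` for `n ≥ C Λ⁸ / p`, if `C` is large. -/
lemma mul_add_log_pow_le {A C Λ p : ℝ} (hA : 1 ≤ A) (hC : (14641 * A) ^ 2 ≤ C) (hΛ : 1 ≤ Λ)
    (hp : 0 < p) (hp1 : p ≤ 1) (hpΛ : Real.log (1 / p) ≤ 2 * Λ) {n : ℕ}
    (hn : 1 / p * (C * Λ ^ 8) ≤ n) : 1 ≤ n ∧ A * (Λ + Real.log n) ^ 4 ≤ p * n := by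
  have hC1 : 1 ≤ C := le_trans (by nlinarith) hC
  have hy : C * Λ ^ 8 ≤ p * n := by
    rw [one_div, inv_mul_le_iff₀ hp] at hn
    exact hn
  have hΛ8 : 1 ≤ Λ ^ 8 := one_le_pow₀ hΛ
  have hy1 : 1 ≤ p * n := le_trans (by nlinarith) hy
  have hn0 : (0 : ℝ) < n := by
    by_contra! h
    nlinarith
  have hn1 : 1 ≤ n := by
    have : 0 < n := by exact_mod_cast hn0
    omega
  refine ⟨hn1, ?_⟩
  -- With `t = (p n) ^ (1 / 8)` one has `Λ ≤ t` and `log n ≤ 8 t + 2 Λ`, so `Λ + log n ≤ 11 t`. It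
  -- remains that `11 ^ 4 A ≤ t ^ 4`, which is what `C` provides.
  obtain ⟨t, ht0, ht⟩ : ∃ t : ℝ, 0 < t ∧ t ^ 8 = p * n :=
    ⟨(p * n) ^ (((8 : ℕ) : ℝ)⁻¹), Real.rpow_pos_of_pos (by linarith) _,
      Real.rpow_inv_natCast_pow (by linarith) (by norm_num)⟩
  have hΛt : Λ ≤ t := by
    refine le_of_pow_le_pow_left₀ (n := 8) (by norm_num) ht0.le ?_
    rw [ht]
    nlinarith
  have hlog : Real.log n = Real.log (p * n) + Real.log (1 / p) := by
    rw [← Real.log_mul (by positivity) (by positivity)]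
    congr 1
    field_simp
  have hlogy : Real.log (p * n) ≤ 8 * t := by
    rw [← ht, Real.log_pow]
    have := Real.log_le_sub_one_of_pos ht0
    push_cast
    linarith
  have hlogn : 0 ≤ Real.log n := Real.log_nonneg (by exact_mod_cast hn1)
  have hQ : Λ + Real.log n ≤ 11 * t := by linarith
  have ht4 : 14641 * A ≤ t ^ 4 := by
    refine le_of_pow_le_pow_left₀ (n := 2) (by norm_num) (by positivity) ?_
    rw [← pow_mul]
    norm_num only
    rw [ht]
    nlinarith
  calc A * (Λ + Real.log n) ^ 4 ≤ A * (11 * t) ^ 4 := by gcongr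
    _ = 14641 * A * t ^ 4 := by ring
    _ ≤ t ^ 4 * t ^ 4 := by gcongr
    _ = p * n := by rw [← ht]; ring

variable {α β γ ε δ K Q : ℝ} {n : ℕ}

lemma log_eight_le : Real.log 8 ≤ 3 := by
  have h : Real.log 8 = 3 * Real.log 2 := by
    rw [show (8 : ℝ) = 2 ^ 3 by norm_num, Real.log_pow]
    norm_num
  linarith [Real.log_two_lt_d9]

lemma log_inv_nonneg {a : ℝ} (ha : 0 < a) (ha1 : a ≤ 1) : 0 ≤ Real.log (1 / a) :=
  Real.log_nonneg (by rwa [one_le_div ha])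

lemma numRuns_le (hβ : 0 < β) (hβ1 : β ≤ 1) (hQ : 1 ≤ Q) (hβQ : Real.log (1 / β) ≤ Q) :
    (numRuns β : ℝ) ≤ 5 * Q := by
  have h1 : Real.log (8 / β) = Real.log 8 + Real.log (1 / β) := by
    rw [← Real.log_mul (by norm_num) (by positivity)]
    congr 1
    ring
  have h0 : 0 ≤ Real.log (8 / β) := by
    rw [h1]
    have := log_inv_nonneg hβ hβ1
    have := Real.log_nonneg (by norm_num : (1 : ℝ) ≤ 8)
    linarith
  have := (Nat.ceil_lt_add_one h0).le
  unfold numRuns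
  have := log_eight_le
  linarith

lemma log_projDim_eq (hα : 0 < α) (hβ : 0 < β) (hn : 1 ≤ n) :
    Real.log (1 / (α * β ^ 2 / (64 * n)))
      = 2 * Real.log 8 + Real.log n + Real.log (1 / α) + 2 * Real.log (1 / β) := by
  have hn0 : (0 : ℝ) < n := by exact_mod_cast hn
  have h : 1 / (α * β ^ 2 / (64 * n)) = 8 ^ 2 * n * (1 / α) * (1 / β) ^ 2 := by
    field_simp
    norm_num
  rw [h, Real.log_mul (by positivity) (by positivity), Real.log_mul (by positivity) (by positivity),
    Real.log_mul (by positivity) (by positivity), Real.log_pow, Real.log_pow]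
  push_cast
  ring

lemma one_le_projDim (hα : 0 < α) (hα1 : α ≤ 1) (hβ : 0 < β) (hβ1 : β ≤ 1) (hγ : 0 < γ)
    (hK : 0 < K) (hn : 1 ≤ n) : 1 ≤ projDim K α β γ n := by
  refine Nat.one_le_ceil_iff.2 (div_pos (mul_pos hK ?_) (by positivity))
  rw [log_projDim_eq hα hβ hn]
  have h1 := log_inv_nonneg hα hα1
  have h2 := log_inv_nonneg hβ hβ1
  have h3 : 0 ≤ Real.log n := Real.log_nonneg (by exact_mod_cast hn)
  have h4 := Real.log_pos (by norm_num : (1 : ℝ) < 8)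
  linarith

lemma projDim_le (hα : 0 < α) (hα1 : α ≤ 1) (hβ : 0 < β) (hβ1 : β ≤ 1) (hγ : 0 < γ) (hγ1 : γ ≤ 1)
    (hK : 1 ≤ K) (hn : 1 ≤ n) (hQ : 1 ≤ Q)
    (hQ' : Real.log n + Real.log (1 / α) + Real.log (1 / β) ≤ Q) :
    (projDim K α β γ n : ℝ) ≤ 9 * K * Q / γ ^ 2 := by
  have h1 := log_inv_nonneg hα hα1
  have h2 := log_inv_nonneg hβ hβ1
  have h3 : 0 ≤ Real.log n := Real.log_nonneg (by exact_mod_cast hn)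
  have h4 := Real.log_pos (by norm_num : (1 : ℝ) < 8)
  have h5 := log_eight_le
  have h6 : Real.log (1 / (α * β ^ 2 / (64 * n))) ≤ 8 * Q := by
    rw [log_projDim_eq hα hβ hn]
    linarith
  have h7 : 0 ≤ Real.log (1 / (α * β ^ 2 / (64 * n))) := by
    rw [log_projDim_eq hα hβ hn]
    linarith
  have hγ2 : γ ^ 2 ≤ 1 := by nlinarith
  refine (Nat.ceil_lt_add_one (by positivity)).le.trans ?_
  rw [← le_sub_iff_add_le]
  have h8 : 9 * K * Q / γ ^ 2 - 1 = (9 * K * Q - γ ^ 2) / γ ^ 2 := by field_simp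
  rw [h8]
  gcongr
  have h9 : K * Real.log (1 / (α * β ^ 2 / (64 * n))) ≤ K * (8 * Q) := by gcongr
  nlinarith

/-- The dominant term is `√m σ / n`: `√m` is of order `√(M Q) / γ`, and `σ / n` of order `Q k / (γ
ε)` with `k ≤ 5 Q`. The resulting `√M Q ^ (5 / 2)` is rounded up to `M Q ^ 3` to avoid roots. -/
lemma gradBound_le {m k : ℕ} {M : ℝ} (hn : 1 ≤ n) (hγ : 0 < γ) (hγ1 : γ ≤ 1) (hε : 0 < ε)
    (hε1 : ε ≤ 1) (hδ : 0 < δ) (hδ1 : δ ≤ 1) (hk : 1 ≤ k) (hM : 1 ≤ M) (hQ : 1 ≤ Q)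
    (hm : (m : ℝ) ≤ 9 * M * Q / γ ^ 2)
    (hkQ : (k : ℝ) ≤ 5 * Q) (hQ' : Real.log n + Real.log (1 / δ) ≤ Q) :
    gradBound m n γ (ε / k) (δ / k) / n ≤ 2000 * M * Q ^ 3 / (γ ^ 2 * ε) := by
  have hn0 : (1 : ℝ) ≤ n := by exact_mod_cast hn
  have hk0 : (1 : ℝ) ≤ k := by exact_mod_cast hk
  have hlogk : Real.log k ≤ 5 * Q := by
    have := Real.log_le_sub_one_of_pos (by linarith : (0 : ℝ) < k)
    linarith
  have hlogk0 : 0 ≤ Real.log k := Real.log_nonneg hk0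
  have hlogn : 0 ≤ Real.log n := Real.log_nonneg hn0
  have hlogδ := log_inv_nonneg hδ hδ1
  have e1 : Real.log (1 / (δ / k)) = Real.log (1 / δ) + Real.log k := by
    rw [← Real.log_mul (by positivity) (by positivity)]
    congr 1
    field_simp
  have e2 : Real.log (n / (δ / k)) = Real.log n + Real.log (1 / δ) + Real.log k := by
    rw [← Real.log_mul (by positivity) (by positivity),
      ← Real.log_mul (by positivity) (by positivity)]
    congr 1
    field_simp
  have h1 : Real.log (1 / (δ / k)) ≤ 6 * Q := by linarith
  have h2 : Real.log (n / (δ / k)) ≤ 6 * Q := by linarith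
  have h10 : 0 ≤ Real.log (1 / (δ / k)) := by linarith
  have h20 : 0 ≤ Real.log (n / (δ / k)) := by linarith
  have hL : lossLip γ ^ 2 ≤ 2 / γ ^ 2 := by
    rw [lossLip, div_pow, div_le_div_iff₀ (by positivity) (by positivity)]
    nlinarith [sq_nonneg γ]
  rw [div_le_iff₀ (by linarith)]
  refine Real.sqrt_le_iff.2 ⟨by positivity, ?_⟩
  rw [noiseSD, Real.sq_sqrt (by positivity)]
  have h3 : (m : ℝ) * (32 * lossLip γ ^ 2 * n ^ 2 * Real.log (n / (δ / k)) * Real.log (1 / (δ / k))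
      / (ε / k) ^ 2) ≤ (9 * M * Q / γ ^ 2) * (32 * (2 / γ ^ 2) * n ^ 2 * (6 * Q) * (6 * Q)
      / (ε / (5 * Q)) ^ 2) := by
    gcongr
  have h4 : (n : ℝ) ^ 2 * lossLip γ ^ 2 ≤ n ^ 2 * (2 / γ ^ 2) := by gcongr
  have h5 : (n : ℝ) ^ 2 * (2 / γ ^ 2) ≤ n ^ 2 * (2 * M ^ 2 * Q ^ 6 / (γ ^ 4 * ε ^ 2)) := by
    refine mul_le_mul_of_nonneg_left ?_ (by positivity)
    rw [div_le_div_iff₀ (by positivity) (by positivity)]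
    have hγ2 : γ ^ 4 * ε ^ 2 ≤ γ ^ 2 := by
      have h6 : γ ^ 2 ≤ 1 := pow_le_one₀ hγ.le hγ1
      have h7 : ε ^ 2 ≤ 1 := pow_le_one₀ hε.le hε1
      have : γ ^ 4 * ε ^ 2 = γ ^ 2 * (γ ^ 2 * ε ^ 2) := by ring
      rw [this]
      exact mul_le_of_le_one_right (by positivity) (mul_le_one₀ h6 (by positivity) h7)
    have hMQ : 1 ≤ M ^ 2 * Q ^ 6 := one_le_mul_of_one_le_of_one_le (one_le_pow₀ hM) (one_le_pow₀ hQ)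
    nlinarith [sq_nonneg γ]
  have h6 : (9 * M * Q / γ ^ 2) * (32 * (2 / γ ^ 2) * n ^ 2 * (6 * Q) * (6 * Q)
      / (ε / (5 * Q)) ^ 2) = n ^ 2 * (518400 * (M * Q ^ 5) / (γ ^ 4 * ε ^ 2)) := by
    field_simp
    ring
  have h7 : n ^ 2 * (518400 * (M * Q ^ 5) / (γ ^ 4 * ε ^ 2))
      ≤ n ^ 2 * (518400 * (M ^ 2 * Q ^ 6) / (γ ^ 4 * ε ^ 2)) := by
    have : M * Q ^ 5 ≤ M ^ 2 * Q ^ 6 := by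
      gcongr
      · nlinarith
      · norm_num
    gcongr
  have h8 : (2000 * M * Q ^ 3 / (γ ^ 2 * ε) * n) ^ 2
      = n ^ 2 * (4000000 * (M ^ 2 * Q ^ 6) / (γ ^ 4 * ε ^ 2)) := by
    field_simp
    norm_num
  have h9 : (n : ℝ) ^ 2 * (2 * M ^ 2 * Q ^ 6 / (γ ^ 4 * ε ^ 2))
      + n ^ 2 * (518400 * (M ^ 2 * Q ^ 6) / (γ ^ 4 * ε ^ 2))
      = n ^ 2 * (518402 * (M ^ 2 * Q ^ 6) / (γ ^ 4 * ε ^ 2)) := by ring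
  have h11 : n ^ 2 * (518402 * (M ^ 2 * Q ^ 6) / (γ ^ 4 * ε ^ 2))
      ≤ n ^ 2 * (4000000 * (M ^ 2 * Q ^ 6) / (γ ^ 4 * ε ^ 2)) := by
    gcongr
    norm_num
  rw [h8]
  linarith

lemma log_numRuns_div_le (hβ : 0 < β) (hβ1 : β ≤ 1) (hQ : 1 ≤ Q) (hβQ : Real.log (1 / β) ≤ Q) :
    Real.log (numRuns β / (β / 8)) ≤ 9 * Q := by
  have hk : (1 : ℝ) ≤ numRuns β := by exact_mod_cast one_le_numRuns hβ hβ1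
  have hkQ := numRuns_le hβ hβ1 hQ hβQ
  have h1 : Real.log (numRuns β / (β / 8))
      = Real.log (numRuns β) + Real.log 8 + Real.log (1 / β) := by
    rw [← Real.log_mul (by positivity) (by positivity),
      ← Real.log_mul (by positivity) (by positivity)]
    congr 1
    field_simp
  have := Real.log_le_sub_one_of_pos (by linarith : (0 : ℝ) < numRuns β)
  have := log_eight_le
  rw [h1]
  linarith

/-- The error terms of the private empirical risk minimizer are at most `α n / 100`. -/
lemma runBound_add_le {m : ℕ} {M : ℝ} (hn : 1 ≤ n) (hβ : 0 < β) (hβ1 : β ≤ 1)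
    (hγ : 0 < γ) (hγ1 : γ ≤ 1) (hε : 0 < ε) (hε1 : ε ≤ 1) (hδ : 0 < δ) (hδ1 : δ ≤ 1) (hM : 1 ≤ M)
    (hQ : 1 ≤ Q) (hm : (m : ℝ) ≤ 9 * M * Q / γ ^ 2) (hβQ : Real.log (1 / β) ≤ Q)
    (hQ' : Real.log n + Real.log (1 / δ) ≤ Q)
    (hmain : 10 ^ 7 * M ^ 2 * Q ^ 4 ≤ α * ε * γ ^ 2 * n) :
    runBound m n γ (ε / numRuns β) (δ / numRuns β)
      + 2 * (3 / γ) * Real.log (numRuns β / (β / 8)) / ε ≤ α * n / 100 := by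
  have hn0 : (1 : ℝ) ≤ n := by exact_mod_cast hn
  have hlogn : 0 ≤ Real.log n := Real.log_nonneg hn0
  have hlogδ := log_inv_nonneg hδ hδ1
  have hG := gradBound_le hn hγ hγ1 hε hε1 hδ hδ1 (one_le_numRuns hβ hβ1) hM hQ hm
    (numRuns_le hβ hβ1 hQ hβQ) hQ'
  have hR : runBound m n γ (ε / numRuns β) (δ / numRuns β)
      ≤ 2.8 * (2000 * M * Q ^ 3 / (γ ^ 2 * ε) * (10 * Q)) := by
    unfold runBound
    have h1 : Real.exp 1 ≤ 2.8 := by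
      have := Real.exp_one_lt_d9
      linarith
    have h2 : 4 + 6 * Real.log n ≤ 10 * Q := by linarith
    have h3 : 0 ≤ gradBound m n γ (ε / numRuns β) (δ / numRuns β) / n :=
      div_nonneg (Real.sqrt_nonneg _) (by linarith)
    gcongr
  have hE : 2 * (3 / γ) * Real.log (numRuns β / (β / 8)) / ε ≤ 2 * (3 / γ) * (9 * Q) / ε := by
    have := log_numRuns_div_le hβ hβ1 hQ hβQ
    gcongr
  have hE2 : 2 * (3 / γ) * (9 * Q) / ε ≤ 54 * (M * Q ^ 4) / (γ ^ 2 * ε) := by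
    have e : 2 * (3 / γ) * (9 * Q) / ε = 54 * (γ * Q) / (γ ^ 2 * ε) := by
      field_simp
      norm_num
    have h1 : γ * Q ≤ M * Q ^ 4 := by
      have : Q ≤ Q ^ 4 := le_self_pow₀ hQ (by norm_num)
      have : γ ≤ M := hγ1.trans hM
      gcongr
    rw [e]
    gcongr
  have hR2 : 2.8 * (2000 * M * Q ^ 3 / (γ ^ 2 * ε) * (10 * Q))
      = 56000 * (M * Q ^ 4) / (γ ^ 2 * ε) := by
    field_simp
    norm_num
  have hsum : 56000 * (M * Q ^ 4) / (γ ^ 2 * ε) + 54 * (M * Q ^ 4) / (γ ^ 2 * ε)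
      ≤ α * n / 100 := by
    rw [← add_div, div_le_iff₀ (by positivity)]
    have h1 : M * Q ^ 4 ≤ M ^ 2 * Q ^ 4 := by
      gcongr
      nlinarith
    have h2 : 0 ≤ M ^ 2 * Q ^ 4 := by positivity
    nlinarith
  linarith

/-- The failure probability of the generalization bound is at most `β / 8`. -/
lemma pow_mul_exp_le {m : ℕ} {M : ℝ} (hn : 1 ≤ n) (hm1 : 1 ≤ m) (hα : 0 < α) (hβ : 0 < β)
    (hγ : 0 < γ) (hγ1 : γ ≤ 1) (hε1 : ε ≤ 1) (hM : 1 ≤ M)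
    (hQ : 1 ≤ Q) (hm : (m : ℝ) ≤ 9 * M * Q / γ ^ 2) (hβQ : Real.log (1 / β) ≤ Q)
    (hγQ : Real.log (1 / γ) ≤ Q) (hmain : 10 ^ 7 * M ^ 2 * Q ^ 4 ≤ α * ε * γ ^ 2 * n) :
    (35 * m / γ) ^ m * Real.exp (-(α * n / 2)) ≤ β / 8 := by
  have hm0 : (0 : ℝ) < m := by exact_mod_cast hm1
  have hn0 : (0 : ℝ) < n := by exact_mod_cast hn
  have hx : 0 < 35 * m / γ := by positivity
  have hlog : Real.log (35 * m / γ) ≤ 400 * M * Q := by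
    have h1 : 35 * m / γ ≤ 315 * M * Q * (1 / γ) ^ 3 := by
      calc 35 * m / γ ≤ 35 * (9 * M * Q / γ ^ 2) / γ := by gcongr
        _ = _ := by
          field_simp
          norm_num
    have h2 := Real.log_le_log hx h1
    rw [Real.log_mul (by positivity) (by positivity), Real.log_pow] at h2
    have h3 := Real.log_le_sub_one_of_pos (by positivity : 0 < 315 * M * Q)
    have h4 : Q ≤ M * Q := le_mul_of_one_le_left (by linarith) hM
    push_cast at h2
    nlinarith
  have hlogβ : Real.log (β / 8) = -(Real.log 8 + Real.log (1 / β)) := by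
    rw [Real.log_div (by positivity) (by norm_num), one_div, Real.log_inv]
    ring
  rw [← Real.exp_log hx, ← Real.exp_nat_mul, ← Real.exp_add,
    ← Real.exp_log (by positivity : 0 < β / 8)]
  refine Real.exp_le_exp.2 ?_
  rw [hlogβ]
  have h8 := log_eight_le
  -- The logarithm of the net size is of order `M ^ 2 Q ^ 2 / γ ^ 2`, which `hmain` makes smaller
  -- than `α n / 2`.
  have h1 : m * Real.log (35 * m / γ) ≤ (9 * M * Q / γ ^ 2) * (400 * M * Q) := by
    calc m * Real.log (35 * m / γ) ≤ m * (400 * M * Q) := by gcongr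
      _ ≤ _ := by gcongr
  have hγ2 : γ ^ 2 ≤ 1 := pow_le_one₀ hγ.le hγ1
  have h2 : (9 * M * Q / γ ^ 2) * (400 * M * Q) + 4 * Q ≤ α * n / 2 := by
    have e : (9 * M * Q / γ ^ 2) * (400 * M * Q) + 4 * Q
        = (3600 * (M ^ 2 * Q ^ 2) + 4 * (Q * γ ^ 2)) / γ ^ 2 := by
      field_simp
      ring
    rw [e, div_le_iff₀ (by positivity)]
    have h3 : M ^ 2 * Q ^ 2 ≤ M ^ 2 * Q ^ 4 := by
      gcongr
      norm_num
    have h4 : Q * γ ^ 2 ≤ M ^ 2 * Q ^ 4 := by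
      have : Q ≤ Q ^ 4 := le_self_pow₀ hQ (by norm_num)
      have : (1 : ℝ) ≤ M ^ 2 := one_le_pow₀ hM
      calc Q * γ ^ 2 ≤ Q ^ 4 * 1 := by gcongr
        _ ≤ M ^ 2 * Q ^ 4 := by nlinarith [pow_pos (by linarith : 0 < Q) 4]
    have h5 : α * ε * γ ^ 2 * n ≤ α * n * γ ^ 2 := by
      have : α * ε * γ ^ 2 * n = ε * (α * n * γ ^ 2) := by ring
      rw [this]
      exact mul_le_of_le_one_left (by positivity) hε1
    have h6 : 0 ≤ M ^ 2 * Q ^ 4 := by positivity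
    nlinarith
  linarith

/-- The failure probability of the random projection, for a single vector. -/
lemma exp_projDim_le (hα : 0 < α) (hβ : 0 < β) (hγ : 0 < γ)
    (hlog : 0 ≤ Real.log (1 / (α * β ^ 2 / (64 * n))))
    (hn : 1 ≤ n) (hK : 1.4 * 10 ^ 7 ≤ K) :
    Real.exp (-((γ / 100) ^ 2 * projDim K α β γ n / 1360)) ≤ α * β ^ 2 / (64 * n) := by
  have hn0 : (0 : ℝ) < n := by exact_mod_cast hn
  have hb : 0 < α * β ^ 2 / (64 * n) := by positivity
  rw [← Real.exp_log hb]
  refine Real.exp_le_exp.2 ?_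
  have h1 : K * Real.log (1 / (α * β ^ 2 / (64 * n))) / γ ^ 2 ≤ projDim K α β γ n := Nat.le_ceil _
  rw [one_div, Real.log_inv] at h1 hlog
  rw [div_le_iff₀ (by positivity)] at h1
  -- Numerically, `100 ^ 2 * 1360 = 1.36 * 10 ^ 7`, which is below the assumed lower bound for `K`.
  nlinarith

end SampleSize

/-! ### Accuracy -/

section Accuracy

variable {d m : ℕ}

lemma label_eq_sign_iff (w : E d) (z : Example d) :
    label z = Real.sign (inner ℝ w z.1) ↔ 0 < margin w z := by
  unfold margin
  rcases label_eq_or z with h | h <;> rcases lt_trichotomy (inner ℝ w z.1) 0 with h' | h' | h'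
  · rw [h, Real.sign_of_neg h']
    constructor <;> intro <;> linarith
  · rw [h, h', Real.sign_zero]
    simp
  · rw [h, Real.sign_of_pos h']
    simpa using h'
  · rw [h, Real.sign_of_neg h']
    simpa using h'
  · rw [h, h', Real.sign_zero]
    simp
  · rw [h, Real.sign_of_pos h']
    constructor <;> intro <;> linarith

lemma accuracy_eq (D : Measure (Example d)) (w : E d) :
    accuracy D w = D.real {z | 0 < margin w z} := by
  simp_rw [accuracy, label_eq_sign_iff]

lemma measurable_accuracy (D : Measure (Example d)) [IsProbabilityMeasure D] :
    Measurable (accuracy D) := by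
  have hs : MeasurableSet {p : E d × Example d | 0 < margin p.1 p.2} :=
    measurableSet_lt measurable_const (measurable_margin measurable_fst measurable_snd)
  have h : accuracy D = fun w =>
      (D (Prod.mk w ⁻¹' {p : E d × Example d | 0 < margin p.1 p.2})).toReal := by
    ext w
    rw [accuracy_eq]
    rfl
  rw [h]
  exact (measurable_measure_prodMk_left hs).ennreal_toReal

lemma accuracy_eq_one_sub (D : Measure (Example d)) [IsProbabilityMeasure D] (w : E d) :
    accuracy D w = 1 - D.real {z | margin w z ≤ 0} := by
  have hs : MeasurableSet {z : Example d | margin w z ≤ 0} :=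
    measurableSet_le (measurable_margin measurable_const measurable_id) measurable_const
  rw [accuracy_eq, ← probReal_compl_eq_one_sub hs]
  congr 1
  ext z
  simp

/-- The map `(x, y) ↦ (A x / ‖A x‖, y)`. -/
noncomputable def projectExample (A : Matrix (Fin m) (Fin d) ℝ) (z : Example d) : Example m :=
  (‖matVec A z.1‖⁻¹ • matVec A z.1, z.2)

lemma measurable_projectExample (A : Matrix (Fin m) (Fin d) ℝ) :
    Measurable (projectExample A) := by
  unfold projectExample
  have := (continuous_matVec A).measurable
  fun_prop

lemma norm_projectExample_le (A : Matrix (Fin m) (Fin d) ℝ) (z : Example d) :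
    ‖(projectExample A z).1‖ ≤ 1 := by
  simp only [projectExample, norm_smul, norm_inv, norm_norm]
  exact inv_mul_le_one

lemma inner_matVec_transpose (A : Matrix (Fin m) (Fin d) ℝ) (v : E m) (x : E d) :
    inner ℝ (matVec A.transpose v) x = inner ℝ v (matVec A x) := by
  simp only [matVec, PiLp.inner_apply, RCLike.inner_apply, conj_trivial]
  have := Matrix.dotProduct_mulVec v.ofLp A x.ofLp
  rw [← Matrix.mulVec_transpose] at this
  simp only [dotProduct] at this
  calc _ = ∑ i, (A.transpose.mulVec v.ofLp) i * x.ofLp i :=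
        Finset.sum_congr rfl fun i _ => mul_comm _ _
    _ = _ := this.symm
    _ = _ := Finset.sum_congr rfl fun i _ => mul_comm _ _

/-- Both margins are nonnegative multiples of `y ⟨v, A x⟩`, since `⟨Aᵀ v, x⟩ = ⟨v, A x⟩`. If `A x =
0`, both vanish and the point is an error on either side. -/
lemma margin_projBall_matVec_transpose_le_iff (A : Matrix (Fin m) (Fin d) ℝ) (v : E m)
    (z : Example d) :
    margin (projBall (matVec A.transpose v)) z ≤ 0 ↔ margin v (projectExample A z) ≤ 0 := by
  set u := matVec A.transpose v with hu
  have h1 : margin (projBall u) z = (max 1 ‖u‖)⁻¹ * (label z * inner ℝ v (matVec A z.1)) := by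
    rw [margin, projBall, real_inner_smul_left, hu, inner_matVec_transpose]
    ring
  have h2 : margin v (projectExample A z)
      = ‖matVec A z.1‖⁻¹ * (label z * inner ℝ v (matVec A z.1)) := by
    rw [margin, projectExample, real_inner_smul_right]
    simp only [label]
    ring
  rw [h1, h2]
  have hpos : 0 < (max 1 ‖u‖)⁻¹ := inv_pos.2 (lt_max_of_lt_left one_pos)
  by_cases h0 : matVec A z.1 = 0
  · simp [h0]
  · have hpos' : 0 < ‖matVec A z.1‖⁻¹ := inv_pos.2 (norm_pos_iff.2 h0)
    rw [mul_nonpos_iff_pos_imp_nonpos.trans ⟨fun h => h.1 hpos, fun h => ?_⟩,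
      mul_nonpos_iff_pos_imp_nonpos.trans ⟨fun h => h.1 hpos', fun h => ?_⟩]
    all_goals
      exact mul_nonpos_iff_pos_imp_nonpos.1 (mul_nonpos_of_nonneg_of_nonpos (by positivity) h)

end Accuracy

/-- Uniform convergence covers only the unit ball, so the selected run must lie there; the selection
merely returns one of the runs. -/
lemma ae_norm_le_privateERM {m n : ℕ} (hn : 1 ≤ n) {β γ : ℝ} (hγ : 0 < γ) (ε δ : ℝ) {w₁ : E m}
    (hw₁ : ‖w₁‖ ≤ 1) (T : Fin n → Example m) :
    privateERM β γ ε δ w₁ T {w | 1 < ‖w‖} = 0 := by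
  have := isProbabilityMeasure_noiseGD hn γ (ε / numRuns β) (δ / numRuns β) w₁ T
  have hs : MeasurableSet {w : E m | 1 < ‖w‖} := measurableSet_lt measurable_const measurable_norm
  rw [privateERM, Measure.bind_apply hs (measurable_expMechanism_map_left hγ ε T).aemeasurable]
  have hball : ∀ᵐ W ∂(Measure.pi fun _ : Fin (numRuns β) =>
      noiseGD γ (ε / numRuns β) (δ / numRuns β) w₁ T), ∀ i, ‖W i‖ ≤ 1 := by
    rw [ae_all_iff]
    intro i
    exact (measurePreserving_eval (fun _ : Fin (numRuns β) =>
      noiseGD γ (ε / numRuns β) (δ / numRuns β) w₁ T) i).quasiMeasurePreserving.ae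
      (ae_norm_le_noiseGD γ _ _ hw₁ T)
  refine (lintegral_congr_ae (g := fun _ => 0) (hball.mono fun W hW => ?_)).trans lintegral_zero
  have h0 : W ⁻¹' {w | 1 < ‖w‖} = ∅ := by
    ext i
    simpa using hW i
  rw [Measure.map_apply (measurable_of_countable _) hs, h0, measure_empty]

/-! ### The main theorem -/

section Main

variable {d m n : ℕ}

/-- The random projection fails to preserve the norms of the relevant vectors. -/
def ProjectionFails (A : Matrix (Fin m) (Fin d) ℝ) (τ : ℝ) (w : E d) (S : Fin n → Example d) :
    Prop :=
  ∃ i, Distorts A τ w ∨ Distorts A τ (S i).1 ∨ Distorts A τ (w + (S i).1) ∨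
    Distorts A τ (w - (S i).1)

lemma signLaw_projectionFails_le (hm : 1 ≤ m) {τ : ℝ} (hτ : 0 < τ) (hτ1 : τ ≤ 1) (w : E d)
    (S : Fin n → Example d) :
    signLaw m d {s | ProjectionFails (signMatrix s) τ w S}
      ≤ ENNReal.ofReal (8 * n * Real.exp (-(τ ^ 2 * m / 1360))) := by
  set p := ENNReal.ofReal (2 * Real.exp (-(τ ^ 2 * m / 1360))) with hp
  have h : ∀ u : E d, signLaw m d {s | Distorts (signMatrix s) τ u} ≤ p := fun u =>
    signLaw_distorts_le u hm hτ hτ1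
  have hsub : {s | ProjectionFails (signMatrix s) τ w S} ⊆ ⋃ i : Fin n,
      ({s : Fin m → Fin d → ℤˣ | Distorts (signMatrix s) τ w} ∪
      ({s | Distorts (signMatrix s) τ (S i).1} ∪ ({s | Distorts (signMatrix s) τ (w + (S i).1)} ∪
        {s | Distorts (signMatrix s) τ (w - (S i).1)}))) := by
    rintro s ⟨i, hi⟩
    exact Set.mem_iUnion.2 ⟨i, hi⟩
  refine (measure_mono hsub).trans ((measure_iUnion_fintype_le _ _).trans ?_)
  have hi : ∀ i : Fin n, signLaw m d ({s | Distorts (signMatrix s) τ w} ∪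
      ({s | Distorts (signMatrix s) τ (S i).1} ∪ ({s | Distorts (signMatrix s) τ (w + (S i).1)} ∪
        {s | Distorts (signMatrix s) τ (w - (S i).1)}))) ≤ p + (p + (p + p)) := fun i =>
    (measure_union_le _ _).trans (add_le_add (h _) ((measure_union_le _ _).trans
      (add_le_add (h _) ((measure_union_le _ _).trans (add_le_add (h _) (h _))))))
  refine (Finset.sum_le_sum fun i _ => hi i).trans (le_of_eq ?_)
  have hx := Real.exp_pos (-(τ ^ 2 * m / 1360))
  rw [Finset.sum_const, Finset.card_univ, Fintype.card_fin, nsmul_eq_mul, hp,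
    ← ENNReal.ofReal_add (by positivity) (by positivity),
    ← ENNReal.ofReal_add (by positivity) (by positivity),
    ← ENNReal.ofReal_add (by positivity) (by positivity), ← ENNReal.ofReal_natCast,
    ← ENNReal.ofReal_mul (by positivity)]
  congr 1
  ring

/-- The learner errs only if the projection, the generalization, or the empirical risk minimization
fails. -/
lemma privateERM_error_le (hn : 1 ≤ n) {α β γ ε δ : ℝ} (hβ : 0 < β) (hβ1 : β ≤ 1)
    (hγ : 0 < γ) (hγ1 : γ ≤ 1) (hε : 0 < ε)
    (herm : runBound m n γ (ε / numRuns β) (δ / numRuns β)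
      + 2 * (3 / γ) * Real.log (numRuns β / (β / 8)) / ε ≤ α * n / 100)
    {w₁ : E m} (hw₁ : ‖w₁‖ ≤ 1) {D : Measure (Example d)} [IsProbabilityMeasure D]
    {A : Matrix (Fin m) (Fin d) ℝ} {w : E d} (hw : ‖w‖ ≤ 1) {S : Fin n → Example d}
    (hS : ∀ i, ‖(S i).1‖ ≤ 1) (hSw : ∀ i, γ ≤ margin w (S i))
    (hA : ¬ ProjectionFails A (γ / 100) w S)
    (hgen : ∀ v : E m, ‖v‖ ≤ 1 → totalLoss γ v (fun i => projectExample A (S i)) ≤ α * n / 100 →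
      D.real {z | margin v (projectExample A z) ≤ 0} ≤ α) :
    privateERM β γ ε δ w₁ (projectData A S)
      {v | ¬ 1 - α ≤ accuracy D (projBall (matVec A.transpose v))}
      ≤ ENNReal.ofReal (β / 8) + ENNReal.ofReal (β / 8) := by
  -- The image of the true separator is the zero-loss comparator needed by the optimization bound.
  have h0 : totalLoss γ (projBall (matVec A w)) (projectData A S) = 0 := by
    refine Finset.sum_eq_zero fun i _ => loss_eq_zero ?_
    simp only [ProjectionFails, not_exists, not_or] at hA
    obtain ⟨h1, h2, h3, h4⟩ := hA i
    exact le_margin_projBall_matVec hγ hγ1 hw (hS i) (hSw i) h1 h2 h3 h4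
  have hmain := privateERM_lt_totalLoss_le hn hβ hβ1 hγ hγ1 hε δ hw₁ (norm_projBall_le (matVec A w))
    (norm_projectData_le A S) h0
  have hball := ae_norm_le_privateERM (β := β) hn hγ ε δ hw₁ (projectData A S)
  have hsub : {v | ¬ 1 - α ≤ accuracy D (projBall (matVec A.transpose v))} ⊆
      {v | 1 < ‖v‖} ∪ {v | runBound m n γ (ε / numRuns β) (δ / numRuns β)
        + 2 * (3 / γ) * Real.log (numRuns β / (β / 8)) / ε < totalLoss γ v (projectData A S)} := by
    intro v hv
    by_contra hcon
    simp only [Set.mem_union, Set.mem_ofPred_eq, not_or, not_lt] at hcon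
    refine hv ?_
    rw [accuracy_eq_one_sub]
    simp_rw [margin_projBall_matVec_transpose_le_iff]
    linarith [hgen v hcon.1 (hcon.2.trans herm)]
  refine (measure_mono hsub).trans ((measure_union_le _ _).trans ?_)
  rw [hball, zero_add]
  exact hmain

open Classical in
/-- The failure probability of the learner. -/
lemma bind_halfspaceLearner_error_le (hn : 1 ≤ n) {K α β γ ε δ : ℝ} (hα : 0 < α) (hβ : 0 < β)
    (hβ1 : β ≤ 1) (hγ : 0 < γ) (hγ1 : γ ≤ 1) (hε : 0 < ε) (hm : 1 ≤ projDim K α β γ n)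
    (herm : runBound (projDim K α β γ n) n γ (ε / numRuns β) (δ / numRuns β)
      + 2 * (3 / γ) * Real.log (numRuns β / (β / 8)) / ε ≤ α * n / 100)
    (hnet : (35 * projDim K α β γ n / γ) ^ projDim K α β γ n * Real.exp (-(α * n / 2)) ≤ β / 8)
    (hproj : 8 * n * Real.exp (-((γ / 100) ^ 2 * projDim K α β γ n / 1360)) ≤ β / 8)
    {w₁ : E (projDim K α β γ n)} (hw₁ : ‖w₁‖ ≤ 1) {D : Measure (Example d)} (hD : HasMargin γ D) :
    (Measure.pi fun _ : Fin n => D).bind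
      (fun S => (halfspaceLearner K α β γ ε δ n w₁ S).map projBall) {w | ¬ 1 - α ≤ accuracy D w}
      ≤ ENNReal.ofReal β := by
  obtain ⟨hprob, hD1, w, hw, hDw⟩ := hD
  have hG : MeasurableSet {w | ¬ 1 - α ≤ accuracy D w} :=
    (measurableSet_le measurable_const (measurable_accuracy D)).compl
  have hLm : Measurable fun S : Fin n → Example d =>
      (halfspaceLearner K α β γ ε δ n w₁ S).map projBall :=
    (Measure.measurable_map _ measurable_projBall).comp
      (measurable_halfspaceLearner d K α β ε δ hn hγ w₁)
  -- For each matrix, the bad samples for generalization: the map into the low-dimensional ball is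
  -- fixed before the sample is drawn.
  choose G hGm hGD hGgen using fun s : Fin (projDim K α β γ n) → Fin d → ℤˣ =>
    exists_measurableSet_error_le D (n := n) hm hγ hγ1 hα.le
      (measurable_projectExample (signMatrix s))
      (norm_projectExample_le (signMatrix s))
  set c := ENNReal.ofReal (β / 8) with hc
  set J : (Fin n → Example d) → Set (Fin (projDim K α β γ n) → Fin d → ℤˣ) :=
    fun S => {s | ProjectionFails (signMatrix s) (γ / 100) w S} with hJ
  have hSae : ∀ᵐ S ∂(Measure.pi fun _ : Fin n => D), ∀ i, ‖(S i).1‖ ≤ 1 ∧ γ ≤ margin w (S i) := by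
    rw [ae_all_iff]
    intro i
    exact (measurePreserving_eval (fun _ : Fin n => D) i).quasiMeasurePreserving.ae (hD1.and hDw)
  rw [Measure.bind_apply hG hLm.aemeasurable]
  -- `G s` is small for each fixed matrix, whereas the algorithm integrates over the matrix first.
  have hswap : ∫⁻ S, ∫⁻ s, (G s).indicator 1 S ∂(signLaw (projDim K α β γ n) d)
      ∂(Measure.pi fun _ : Fin n => D) ≤ c := by
    rw [lintegral_lintegral_swap]
    · calc _ ≤ ∫⁻ _, c ∂(signLaw (projDim K α β γ n) d) := by
            refine lintegral_mono fun s => ?_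
            rw [lintegral_indicator_one (hGm s)]
            exact (hGD s).trans (ENNReal.ofReal_le_ofReal hnet)
        _ = c := by rw [lintegral_const, measure_univ, mul_one]
    · refine Measurable.aemeasurable (measurable_from_prod_countable_left fun s => ?_)
      exact measurable_one.indicator (hGm s)
  calc _ ≤ ∫⁻ S, (c + ∫⁻ s, (G s).indicator 1 S ∂(signLaw (projDim K α β γ n) d) + (c + c))
        ∂(Measure.pi fun _ : Fin n => D) := by
        refine lintegral_mono_ae (hSae.mono fun S hS => ?_)
        have hmeas : MeasurableSet (projBall ⁻¹' {w : E d | ¬ 1 - α ≤ accuracy D w}) :=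
          measurable_projBall hG
        rw [Measure.map_apply measurable_projBall hG, halfspaceLearner,
          Measure.bind_apply hmeas (measurable_of_countable _).aemeasurable]
        calc _ ≤ ∫⁻ s, ((J S).indicator 1 s + (G s).indicator 1 S + (c + c))
              ∂(signLaw (projDim K α β γ n) d) := by
              refine lintegral_mono fun s => ?_
              have hmv : Measurable (matVec (signMatrix s).transpose) :=
                (continuous_matVec (signMatrix s).transpose).measurable
              rw [Measure.map_apply hmv hmeas]
              have := isProbabilityMeasure_privateERM hn hβ hβ1 hγ ε δ w₁
                (projectData (signMatrix s) S)
              -- On either bad event the indicator already pays for the whole mass `1`; otherwise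
              -- the two failures of the empirical risk minimizer give `c + c`.
              by_cases hs : s ∈ J S
              · rw [Set.indicator_of_mem hs, Pi.one_apply, add_assoc]
                exact prob_le_one.trans le_self_add
              by_cases hSG : S ∈ G s
              · rw [Set.indicator_of_mem hSG, Pi.one_apply, add_comm _ (1 : ENNReal), add_assoc]
                exact prob_le_one.trans le_self_add
              · refine le_trans ?_ le_add_self
                exact privateERM_error_le hn hβ hβ1 hγ hγ1 hε herm hw₁ hw (fun i => (hS i).1)
                  (fun i => (hS i).2) hs (hGgen s S hSG)
          _ = ∫⁻ s, (J S).indicator 1 s ∂(signLaw (projDim K α β γ n) d)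
              + ∫⁻ s, (G s).indicator 1 S ∂(signLaw (projDim K α β γ n) d) + (c + c) := by
              rw [lintegral_add_right _ measurable_const,
                lintegral_add_left (measurable_of_countable _), lintegral_const, measure_univ,
                mul_one]
          _ ≤ _ := by
              gcongr
              rw [lintegral_indicator_one (Set.toFinite _).measurableSet]
              exact (signLaw_projectionFails_le hm (by positivity) (by linarith) w S).trans
                (ENNReal.ofReal_le_ofReal hproj)
    _ = c + ∫⁻ S, ∫⁻ s, (G s).indicator 1 S ∂(signLaw (projDim K α β γ n) d)
        ∂(Measure.pi fun _ : Fin n => D) + (c + c) := by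
        rw [lintegral_add_right _ measurable_const, lintegral_add_left measurable_const,
          lintegral_const, lintegral_const, measure_univ, mul_one, mul_one]
    _ ≤ c + c + (c + c) := by gcongr
    _ ≤ _ := by
        rw [hc, ← ENNReal.ofReal_add (by positivity) (by positivity),
          ← ENNReal.ofReal_add (by positivity) (by positivity)]
        exact ENNReal.ofReal_le_ofReal (by linarith)

end Main

end PrivateHalfspace

theorem mainTheorem1 :
    ∃ K₀ : ℝ, 0 < K₀ ∧ ∀ K : ℝ, K₀ ≤ K → ∃ (C : ℝ) (c : ℕ), 0 < C ∧
      ∀ (d : ℕ) (α β γ ε δ : ℝ),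
        0 < α → α ≤ 1 → 0 < β → β ≤ 1 → 0 < γ → γ ≤ 1 → 0 < ε → ε ≤ 1 → 0 < δ → δ ≤ 1 →
        ∀ n : ℕ,
          1 / (α * ε * γ ^ 2) *
            (C * (1 + Real.log (1 / α) + Real.log (1 / β) + Real.log (1 / δ) + Real.log (1 / ε)
              + Real.log (1 / γ)) ^ c) ≤ n →
          ∀ w₁ : PrivateHalfspace.E (PrivateHalfspace.projDim K α β γ n), ‖w₁‖ ≤ 1 →
            PrivateHalfspace.IsPACLearner (d := d) α β γ n
              (fun S => (PrivateHalfspace.halfspaceLearner K α β γ ε δ n w₁ S).map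
                PrivateHalfspace.projBall) := by
  open PrivateHalfspace in
  -- `K₀` comes from `exp_projDim_le`. The pair `C`, `c` is that of `mul_add_log_pow_le` for `A = 10
  -- ^ 7 K ^ 2`, the constant required by `runBound_add_le` and `pow_mul_exp_le`.
  refine ⟨1.4 * 10 ^ 7, by norm_num, fun K hK =>
    ⟨(14641 * (10 ^ 7 * K ^ 2)) ^ 2, 8, by positivity, ?_⟩⟩
  intro d α β γ ε δ hα hα1 hβ hβ1 hγ hγ1 hε hε1 hδ hδ1 n hn w₁ hw₁
  have hK1 : 1 ≤ K := le_trans (by norm_num) hK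
  have hlα := log_inv_nonneg hα hα1
  have hlβ := log_inv_nonneg hβ hβ1
  have hlγ := log_inv_nonneg hγ hγ1
  have hlε := log_inv_nonneg hε hε1
  have hlδ := log_inv_nonneg hδ hδ1
  set Λ := 1 + Real.log (1 / α) + Real.log (1 / β) + Real.log (1 / δ) + Real.log (1 / ε)
    + Real.log (1 / γ) with hΛ
  have hp : 0 < α * ε * γ ^ 2 := by positivity
  have hp1 : α * ε * γ ^ 2 ≤ 1 :=
    mul_le_one₀ (mul_le_one₀ hα1 hε.le hε1) (by positivity) (pow_le_one₀ hγ.le hγ1)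
  have hpΛ : Real.log (1 / (α * ε * γ ^ 2)) ≤ 2 * Λ := by
    have : 1 / (α * ε * γ ^ 2) = 1 / α * (1 / ε) * (1 / γ) ^ 2 := by
      field_simp
    rw [this, Real.log_mul (by positivity) (by positivity),
      Real.log_mul (by positivity) (by positivity), Real.log_pow]
    push_cast
    linarith
  have hA : 1 ≤ 10 ^ 7 * K ^ 2 := by
    have : 1 ≤ K ^ 2 := one_le_pow₀ hK1
    linarith
  obtain ⟨hn1, hmain⟩ := mul_add_log_pow_le hA (le_refl ((14641 * (10 ^ 7 * K ^ 2)) ^ 2))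
    (by linarith : 1 ≤ Λ) hp hp1 hpΛ hn
  have hlogn : 0 ≤ Real.log n := Real.log_nonneg (by exact_mod_cast hn1)
  -- Both `m` and `σ` depend on `log n`, so one quantity `Q` dominates all logarithms; `hmain` has
  -- already resolved the circular condition on `n`.
  set Q := Λ + Real.log n with hQ
  have hQ1 : 1 ≤ Q := by linarith
  have hm1 := one_le_projDim hα hα1 hβ hβ1 hγ (by linarith : 0 < K) hn1
  have hmle := projDim_le hα hα1 hβ hβ1 hγ hγ1 hK1 hn1 hQ1 (by linarith)
  have herm := runBound_add_le hn1 hβ hβ1 hγ hγ1 hε hε1 hδ hδ1 hK1 hQ1 hmle (by linarith)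
    (by linarith) hmain
  have hnet := pow_mul_exp_le hn1 hm1 hα hβ hγ hγ1 hε1 hK1 hQ1 hmle (by linarith) (by linarith)
    hmain
  have hproj : 8 * n * Real.exp (-((γ / 100) ^ 2 * projDim K α β γ n / 1360)) ≤ β / 8 := by
    have hn0 : (0 : ℝ) < n := by exact_mod_cast hn1
    have h1 := exp_projDim_le hα hβ hγ (by
      rw [log_projDim_eq hα hβ hn1]
      have := Real.log_pos (by norm_num : (1 : ℝ) < 8)
      linarith) hn1 hK
    calc 8 * n * Real.exp (-((γ / 100) ^ 2 * projDim K α β γ n / 1360))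
        ≤ 8 * n * (α * β ^ 2 / (64 * n)) := by gcongr
      _ = α * β * (β / 8) := by
        field_simp
        norm_num
      _ ≤ 1 * (β / 8) := by
        gcongr
        exact mul_le_one₀ hα1 hβ.le hβ1
      _ = β / 8 := one_mul _
  have hLm : Measurable fun S : Fin n → Example d =>
      (halfspaceLearner K α β γ ε δ n w₁ S).map projBall :=
    (Measure.measurable_map _ measurable_projBall).comp
      (measurable_halfspaceLearner d K α β ε δ hn1 hγ w₁)
  have hprob : ∀ S : Fin n → Example d,
      IsProbabilityMeasure ((halfspaceLearner K α β γ ε δ n w₁ S).map projBall) := by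
    intro S
    have := isProbabilityMeasure_halfspaceLearner K α ε δ hn1 hβ hβ1 hγ w₁ S
    exact Measure.isProbabilityMeasure_map measurable_projBall.aemeasurable
  refine ⟨hLm, hprob, fun S => ?_, fun D hD => ?_⟩
  · rw [ae_map_iff measurable_projBall.aemeasurable
      (measurableSet_le measurable_norm measurable_const)]
    exact Filter.Eventually.of_forall norm_projBall_le
  · have hDp := hD.1
    have hbp : IsProbabilityMeasure ((Measure.pi fun _ : Fin n => D).bind
        fun S => (halfspaceLearner K α β γ ε δ n w₁ S).map projBall) :=
      isProbabilityMeasure_bind hLm.aemeasurable (Filter.Eventually.of_forall hprob)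
    have herr := bind_halfspaceLearner_error_le hn1 hα hβ hβ1 hγ hγ1 hε hm1 herm hnet hproj hw₁ hD
    have hG : MeasurableSet {w | 1 - α ≤ accuracy D w} :=
      measurableSet_le measurable_const (measurable_accuracy D)
    have hcompl := probReal_compl_eq_one_sub (μ := (Measure.pi fun _ : Fin n => D).bind
        fun S => (halfspaceLearner K α β γ ε δ n w₁ S).map projBall) hG
    have hle : ((Measure.pi fun _ : Fin n => D).bind
        fun S => (halfspaceLearner K α β γ ε δ n w₁ S).map projBall).real
        {w | 1 - α ≤ accuracy D w}ᶜ ≤ β := ENNReal.toReal_le_of_le_ofReal hβ.le herr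
    linarith
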